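/- For $n\ge 1$ let $\varphi^{\mathrm{Wall}}_{\mathrm{Dist}}(n)$ be the following CNF formula, which asserts that circuits computing $x(y+z)$ and $xy+xz$ disagree for some $n$-bit integers $x,y,z$. An adder with input bits $a_0,a_1,a_2$ (missing inputs are the constant $0$) has the sum-bit $a_0\oplus a_1\oplus a_2$ and the carry-bit $\mathrm{MAJ}(a_0,a_1,a_2)$; an adder with a single input is a wire and has no carry-bit. * Circuit $L$ is an $n$-bit ripple-carry adder computing $y+z$ followed by an $(n+1)$-bit Wallace tree multiplier computing $x(y+z)$. Circuit $R$ consists of two $n$-bit Wallace tree multipliers computing $xy$ and $xz$ and a ripple-carry adder that sums their outputs. * An $m$-bit Wallace tree multiplier for $x,y$ starts with the tableau (layer $0$) whose column $i$ lists the products $x_{i-j}\wedge y_j$ ($0\le j<m$, $0\le i-j<m$) by increasing $j$. Given layer $l$, each column is partitioned in order into sets of three variables (the last set may have one or two), each set being the input of an adder. For $j=0,1,2,\dots$ in turn, the sum-bit of the $j$-th adder of every column $i$ is appended to column $i$ of layer $l+1$, and then its carry-bit (if it has at least two inputs) is appended to column $i+1$ of layer $l+1$. The first layer in which every column has at most two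 variables is the last one; its two rows are summed by a carry-lookahead adder (a tree of 4-block propagate/generate units), which gives the output bits. * Each defining constraint $v=f(\dots)$ of a circuit variable is written as the set of clauses that forbid, one by one, the assignments to the variables of the constraint that violate it. Finally there are constraints $e_i = o^L_i\oplus o^R_i$ for all output positions $i$ (missing output bits are $0$) and the clause $\bigvee_i e_i$. A resolution refutation is a sequence of clauses ending with the empty clause, each of which is a clause of the formula or the resolvent of two earlier ones; its size is the number of clauses in the sequence. It is regular if no variable is resolved on more than once along any path of its proof DAG. Theorem. $\varphi^{\mathrm{Wall}}_{\mathrm{Dist}}(n)$ has regular resolution refutations of size $2^{O(\log^2 n)}$: there is a constant $K$ such that for every $n\ge 2$ there is a regular resolution refutation of $\varphi^{\mathrm{Wall}}_{\mathrm{Dist}}(n)$ of size at most $2^{K(\log_2 n)^2}$. -/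

import Mathlib

/-! ### Clauses and regular resolution -/

/-- A literal: `(v, true)` is the positive literal `v`, `(v, false)` is its negation. -/
abbrev Literal (V : Type) := V × Bool

/-- A clause is a finite set of literals (read disjunctively). -/
abbrev Clause (V : Type) := Finset (Literal V)

/-- A CNF formula is a set of clauses (read conjunctively). -/
abbrev CNF (V : Type) := Set (Clause V)

/-- A resolution refutation of `φ`: a sequence of `size` lines, each labelled by a clause.
A line with `rule k = none` is an input clause; a line with `rule k = some (x, i, j)` is the
resolvent on `x` of the clauses of two earlier lines `i` and `j`. The last line is the empty
clause. -/
structure ResolutionRefutation {V : Type} [DecidableEq V] (φ : CNF V) where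
  size : ℕ
  clause : Fin size → Clause V
  rule : Fin size → Option (V × Fin size × Fin size)
  input_mem : ∀ k, rule k = none → clause k ∈ φ
  resolve : ∀ k x i j, rule k = some (x, i, j) →
    i < k ∧ j < k ∧ (x, true) ∈ clause i ∧ (x, false) ∈ clause j ∧
      clause k = (clause i).erase (x, true) ∪ (clause j).erase (x, false)
  ends_empty : ∃ k : Fin size, k.val + 1 = size ∧ clause k = ∅

namespace ResolutionRefutation

variable {V : Type} [DecidableEq V] {φ : CNF V}

/-- `π.Edge a b`: line `b` is one of the two premises of line `a` in the proof DAG. -/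
def Edge (π : ResolutionRefutation φ) (a b : Fin π.size) : Prop :=
  ∃ x i j, π.rule a = some (x, i, j) ∧ (b = i ∨ b = j)

/-- `π.ResolvesOn a x`: line `a` is obtained by resolving on the variable `x`. -/
def ResolvesOn (π : ResolutionRefutation φ) (a : Fin π.size) (x : V) : Prop :=
  ∃ i j, π.rule a = some (x, i, j)

/-- Regularity: no path of the proof DAG contains two distinct inferences that resolve on the
same variable. -/
def IsRegular (π : ResolutionRefutation φ) : Prop :=
  ∀ a b, Relation.TransGen π.Edge a b → ∀ x, π.ResolvesOn a x → ¬ π.ResolvesOn b x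

end ResolutionRefutation

/-! ### Constraints `v = e` and their clauses -/

/-- Boolean expressions. Circuit inputs that do not exist are the constant `zero`. -/
inductive BExpr (V : Type) where
  | zero : BExpr V
  | var : V → BExpr V
  | and : BExpr V → BExpr V → BExpr V
  | or : BExpr V → BExpr V → BExpr V
  | xor : BExpr V → BExpr V → BExpr V

namespace BExpr

variable {V : Type}

def eval (σ : V → Bool) : BExpr V → Bool
  | zero => false
  | var v => σ v
  | and a b => a.eval σ && b.eval σ
  | or a b => a.eval σ || b.eval σ
  | xor a b => Bool.xor (a.eval σ) (b.eval σ)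

def vars [DecidableEq V] : BExpr V → Finset V
  | zero => ∅
  | var v => {v}
  | and a b => a.vars ∪ b.vars
  | or a b => a.vars ∪ b.vars
  | xor a b => a.vars ∪ b.vars

/-- The sum-bit of an adder. -/
def sum3 (a b c : BExpr V) : BExpr V := xor (xor a b) c

/-- The carry-bit of an adder: the majority function. -/
def maj3 (a b c : BExpr V) : BExpr V := or (or (and a b) (and a c)) (and b c)

end BExpr

/-- The clause on the variables `S` that forbids precisely the restriction of `σ` to `S`. -/
def forbid {V : Type} [DecidableEq V] (S : Finset V) (σ : V → Bool) : Clause V :=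
  S.image fun v => (v, !σ v)

/-- The clauses of the constraint `v = e`: one clause for every assignment to the variables
occurring in the constraint that violates it. -/
def constrain {V : Type} [DecidableEq V] (v : V) (e : BExpr V) : CNF V :=
  {C | ∃ σ : V → Bool, σ v ≠ e.eval σ ∧ C = forbid (insert v e.vars) σ}

/-! ### Ripple-carry adder -/

/-- Variables of a ripple-carry adder: carries `c i` (the carry out of column `i`) and
outputs `o i`. -/
inductive RippleVar where
  | c : ℕ → RippleVar
  | o : ℕ → RippleVar
deriving DecidableEq

section Circuits

variable {V : Type} [DecidableEq V]

/-- The carry into column `i` of a ripple-carry adder. -/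
def rippleCarryIn (ι : RippleVar → V) : ℕ → BExpr V
  | 0 => BExpr.zero
  | i + 1 => BExpr.var (ι (RippleVar.c i))

/-- The `N`-bit ripple-carry adder with inputs `a`, `b` and `N + 1` output bits
`o 0, …, o N`; its variables are named through `ι`. -/
def rippleAdder (N : ℕ) (a b : ℕ → BExpr V) (ι : RippleVar → V) : CNF V :=
  (⋃ i < N,
    constrain (ι (RippleVar.o i)) (BExpr.sum3 (rippleCarryIn ι i) (a i) (b i)) ∪
    constrain (ι (RippleVar.c i)) (BExpr.maj3 (rippleCarryIn ι i) (a i) (b i))) ∪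
  constrain (ι (RippleVar.o N)) (rippleCarryIn ι N)

end Circuits

/-! ### Carry-lookahead adder -/

/-- Variables of a carry-lookahead adder: `p l b` and `g l b` are the propagate and generate
bits of the `b`-th block of `4 ^ l` columns, `c i` is the carry into column `i`, and `o i` is
the `i`-th output. -/
inductive CLAVar where
  | p : ℕ → ℕ → CLAVar
  | g : ℕ → ℕ → CLAVar
  | c : ℕ → CLAVar
  | o : ℕ → CLAVar
deriving DecidableEq

section Circuits

variable {V : Type} [DecidableEq V]

/-- Generate function of the blocks `0, …, r`:
`G r ⊕ G (r-1) P r ⊕ ⋯ ⊕ G 0 P 1 ⋯ P r`. -/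
def genExpr (G P : ℕ → BExpr V) : ℕ → BExpr V
  | 0 => G 0
  | r + 1 => BExpr.xor (G (r + 1)) (BExpr.and (P (r + 1)) (genExpr G P r))

/-- Propagate function of the blocks `0, …, r`: `P 0 P 1 ⋯ P r`. -/
def propExpr (P : ℕ → BExpr V) : ℕ → BExpr V
  | 0 => P 0
  | r + 1 => BExpr.and (P (r + 1)) (propExpr P r)

/-- The generate bits of the four blocks of layer `l` that enter the `u`-th 4-block unit of
that layer. -/
def claG (ι : CLAVar → V) (l u q : ℕ) : BExpr V := BExpr.var (ι (CLAVar.g l (4 * u + q)))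

/-- The propagate bits of the four blocks of layer `l` that enter the `u`-th 4-block unit. -/
def claP (ι : CLAVar → V) (l u q : ℕ) : BExpr V := BExpr.var (ι (CLAVar.p l (4 * u + q)))

/-- The carry out of block `r` of the `u`-th unit of layer `l`, computed from the generate and
propagate bits of the blocks `0, …, r` of the unit and from the carry into the unit. -/
def claCarry (ι : CLAVar → V) (l u r : ℕ) : BExpr V :=
  BExpr.xor (genExpr (claG ι l u) (claP ι l u) r)
    (BExpr.and (BExpr.var (ι (CLAVar.c (u * 4 ^ (l + 1))))) (propExpr (claP ι l u) r))

/-- The number of layers of a carry-lookahead adder for `W` columns: the least `L ≥ 1` with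
`W ≤ 4 ^ L`. -/
def claLayers (W : ℕ) : ℕ := max 1 (Nat.clog 4 W)

/-- The `W`-bit carry-lookahead adder with inputs `a`, `b` (which are to be `zero` in the
columns `i ≥ W`) and `W + 1` output bits `o 0, …, o W`; its variables are named through `ι`.
It is a tree of 4-block units with `4 ^ L` columns. Every unit computes the carries into
its blocks 1, 2, 3 and the group propagate and generate bits; the carry into a unit comes from
a higher layer, and only the topmost unit computes the carry out of its last block. -/
def claAdder (W : ℕ) (a b : ℕ → BExpr V) (ι : CLAVar → V) : CNF V :=
  let L := claLayers W
  constrain (ι (CLAVar.c 0)) BExpr.zero ∪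
  (⋃ i < 4 ^ L,
    constrain (ι (CLAVar.g 0 i)) (BExpr.and (a i) (b i)) ∪
    constrain (ι (CLAVar.p 0 i)) (BExpr.xor (a i) (b i))) ∪
  (⋃ l < L, ⋃ u < 4 ^ (L - 1 - l),
    constrain (ι (CLAVar.g (l + 1) u)) (genExpr (claG ι l u) (claP ι l u) 3) ∪
    constrain (ι (CLAVar.p (l + 1) u)) (propExpr (claP ι l u) 3) ∪
    ⋃ r < 3, constrain (ι (CLAVar.c (u * 4 ^ (l + 1) + (r + 1) * 4 ^ l))) (claCarry ι l u r)) ∪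
  constrain (ι (CLAVar.c (4 ^ L))) (claCarry ι (L - 1) 0 3) ∪
  (⋃ i ≤ W,
    constrain (ι (CLAVar.o i)) (BExpr.sum3 (BExpr.var (ι (CLAVar.c i))) (a i) (b i)))

end Circuits

/-! ### Wallace tree multiplier -/

/-- The number of tableau variables in column `i` of layer `l` of the `m`-bit Wallace tree.
Layer `0` holds the products `x_{i-j} y_j`. In each layer every column is partitioned into
consecutive groups of three variables, except that the last group may have one or two; a group
is the input of an adder. Each adder puts its sum-bit into the same column of the next layer,
and each adder with at least two inputs puts its carry-bit into the column one further (an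
adder with one input is a wire: its carry is the constant `0`). -/
def colHeight (m : ℕ) : ℕ → ℕ → ℕ
  | 0, i => min (i + 1) m - (i + 1 - m)
  | l + 1, 0 => (colHeight m l 0 + 2) / 3
  | l + 1, i + 1 => (colHeight m l (i + 1) + 2) / 3 + (colHeight m l i + 1) / 3

/-- The number of sum-bits that layer `l` sends to column `i` of layer `l + 1`. -/
def sumCount (m l i : ℕ) : ℕ := (colHeight m l i + 2) / 3

/-- The number of carry-bits that layer `l` sends to column `i` of layer `l + 1`. -/
def carryCount (m l : ℕ) : ℕ → ℕ
  | 0 => 0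
  | i + 1 => (colHeight m l i + 1) / 3

theorem colHeight_succ (m l i : ℕ) :
    colHeight m (l + 1) i = sumCount m l i + carryCount m l i := by
  cases i <;> simp [colHeight, sumCount, carryCount]

theorem colHeight_le_of_le {m l N : ℕ} (h : ∀ i, colHeight m l i ≤ N) (i : ℕ) :
    colHeight m (l + 1) i ≤ (2 * N + 2) / 3 := by
  have h1 := h i
  cases i with
  | zero => simp only [colHeight]; omega
  | succ i =>
    have h2 := h i
    have h3 : (colHeight m l (i + 1) + 2) / 3 ≤ (N + 2) / 3 := Nat.div_le_div_right (by omega)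
    have h4 : (colHeight m l i + 1) / 3 ≤ (N + 1) / 3 := Nat.div_le_div_right (by omega)
    have h5 : (N + 2) / 3 + (N + 1) / 3 ≤ (2 * N + 2) / 3 := by
      obtain h | h | h : N % 3 = 0 ∨ N % 3 = 1 ∨ N % 3 = 2 := by omega
      all_goals omega
    simp only [colHeight]; omega

theorem colHeight_le (m l : ℕ) : ∀ i, colHeight m l i ≤ max 2 (m - l) := by
  induction l with
  | zero => intro i; simp only [colHeight]; omega
  | succ l ih => intro i; have := colHeight_le_of_le ih i; omega

theorem exists_two_rows (m : ℕ) : ∃ l, ∀ i, colHeight m l i ≤ 2 :=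
  ⟨m, fun i => by have := colHeight_le m m i; omega⟩

theorem colHeight_eq_zero (m l : ℕ) : ∀ i, 2 * m + l ≤ i → colHeight m l i = 0 := by
  induction l with
  | zero => intro i hi; simp only [colHeight]; omega
  | succ l ih =>
    intro i hi
    obtain ⟨i, rfl⟩ : ∃ k, i = k + 1 := ⟨i - 1, by omega⟩
    have h1 := ih (i + 1) (by omega)
    have h2 := ih i (by omega)
    simp only [colHeight]; omega

open Classical in
/-- The index of the last layer: the first layer that has only two rows. -/
noncomputable def lastLayer (m : ℕ) : ℕ := Nat.find (exists_two_rows m)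

theorem exists_width (m : ℕ) : ∃ w, ∀ i, w ≤ i → colHeight m (lastLayer m) i = 0 :=
  ⟨_, colHeight_eq_zero m (lastLayer m)⟩

open Classical in
/-- The number of columns of the last layer. -/
noncomputable def finalWidth (m : ℕ) : ℕ := Nat.find (exists_width m)

/-- Variables of a Wallace tree multiplier: `t l i k` is the `k`-th variable (counted from `0`)
in column `i` of layer `l` of the tableau, `cla v` are the variables of the final
carry-lookahead adder, whose outputs are those of the multiplier. -/
inductive WallaceVar where
  | t : ℕ → ℕ → ℕ → WallaceVar
  | cla : CLAVar → WallaceVar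
deriving DecidableEq

section Circuits

variable {V : Type} [DecidableEq V]

/-- The `k`-th entry of column `i` of layer `l`, or the constant `0` if there is none. -/
def tab (m : ℕ) (ι : WallaceVar → V) (l i k : ℕ) : BExpr V :=
  if k < colHeight m l i then BExpr.var (ι (WallaceVar.t l i k)) else BExpr.zero

/-- The tableau of partial products. Column `i` holds the products `x_{i-j} y_j` with
`0 ≤ j < m` and `0 ≤ i - j < m` in order of increasing `j`; the first such `j` is `i + 1 - m`
(truncated subtraction). -/
def partialProducts (m : ℕ) (x y : ℕ → BExpr V) (ι : WallaceVar → V) : CNF V :=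
  ⋃ i, ⋃ k < colHeight m 0 i,
    constrain (ι (WallaceVar.t 0 i k))
      (BExpr.and (x (i - (k + (i + 1 - m)))) (y (k + (i + 1 - m))))

/-- The adders from layer `l` to layer `l + 1`. The `j`-th adder of column `i` takes the entries
`3j, 3j+1, 3j+2` of that column. The outputs are appended to the columns of the next layer for
`j = 0, 1, 2, …`, for each `j` first all sum-bits and then all carry-bits. So the sum-bit of
adder `j` of column `i` is preceded in column `i` by `j` sum-bits and by the carry-bits
with number less than `j`, and its carry-bit is preceded in column `i + 1` by the sum-bits with
number at most `j` and by `j` carry-bits. -/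
def wallaceLayer (m : ℕ) (ι : WallaceVar → V) (l : ℕ) : CNF V :=
  (⋃ i, ⋃ j, ⋃ (_ : 3 * j < colHeight m l i),
    constrain (ι (WallaceVar.t (l + 1) i (j + min j (carryCount m l i))))
      (BExpr.sum3 (tab m ι l i (3 * j)) (tab m ι l i (3 * j + 1)) (tab m ι l i (3 * j + 2)))) ∪
  (⋃ i, ⋃ j, ⋃ (_ : 3 * j + 1 < colHeight m l i),
    constrain (ι (WallaceVar.t (l + 1) (i + 1) (min (j + 1) (sumCount m l (i + 1)) + j)))
      (BExpr.maj3 (tab m ι l i (3 * j)) (tab m ι l i (3 * j + 1)) (tab m ι l i (3 * j + 2))))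

/-- The `m`-bit Wallace tree multiplier with inputs `x`, `y`; its variables are named
through `ι`. -/
noncomputable def wallaceMul (m : ℕ) (x y : ℕ → BExpr V) (ι : WallaceVar → V) : CNF V :=
  partialProducts m x y ι ∪
  (⋃ l < lastLayer m, wallaceLayer m ι l) ∪
  claAdder (finalWidth m) (fun i => tab m ι (lastLayer m) i 0)
    (fun i => tab m ι (lastLayer m) i 1) (fun v => ι (WallaceVar.cla v))

/-- The number of output bits of the `m`-bit Wallace tree multiplier. -/
noncomputable def wallaceOutputs (m : ℕ) : ℕ := finalWidth m + 1

/-- The first `N` entries of a sequence of variables, continued by the constant `0`. -/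
def bits (N : ℕ) (v : ℕ → V) (i : ℕ) : BExpr V :=
  if i < N then BExpr.var (v i) else BExpr.zero

end Circuits

/-! ### The distributivity instance -/

/-- Variables of the distributivity instance: the input bits, the variables of the five
subcircuits, and the comparison bits. -/
inductive DistVar where
  | x : ℕ → DistVar
  | y : ℕ → DistVar
  | z : ℕ → DistVar
  | addYZ : RippleVar → DistVar
  | mulXYZ : WallaceVar → DistVar
  | mulXY : WallaceVar → DistVar
  | mulXZ : WallaceVar → DistVar
  | addXYXZ : RippleVar → DistVar
  | e : ℕ → DistVar
deriving DecidableEq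

namespace DistVar

/-- Circuit `L`: the adder for `y + z`, and the `(n + 1)`-bit multiplier for `x (y + z)`. -/
noncomputable def circuitL (n : ℕ) : CNF DistVar :=
  rippleAdder n (bits n y) (bits n z) addYZ ∪
  wallaceMul (n + 1) (bits n x) (bits (n + 1) fun i => addYZ (RippleVar.o i)) mulXYZ

/-- Circuit `R`: the `n`-bit multipliers for `x y` and `x z`, and the adder for their sum. -/
noncomputable def circuitR (n : ℕ) : CNF DistVar :=
  wallaceMul n (bits n x) (bits n y) mulXY ∪
  wallaceMul n (bits n x) (bits n z) mulXZ ∪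
  rippleAdder (wallaceOutputs n)
    (bits (wallaceOutputs n) fun i => mulXY (WallaceVar.cla (CLAVar.o i)))
    (bits (wallaceOutputs n) fun i => mulXZ (WallaceVar.cla (CLAVar.o i))) addXYXZ

/-- The output bits of circuit `L`, continued by the constant `0`. -/
noncomputable def outL (n : ℕ) : ℕ → BExpr DistVar :=
  bits (wallaceOutputs (n + 1)) fun i => mulXYZ (WallaceVar.cla (CLAVar.o i))

/-- The output bits of circuit `R`, continued by the constant `0`. -/
noncomputable def outR (n : ℕ) : ℕ → BExpr DistVar :=
  bits (wallaceOutputs n + 1) fun i => addXYXZ (RippleVar.o i)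

/-- The number of output positions that are compared. -/
noncomputable def numOut (n : ℕ) : ℕ := max (wallaceOutputs (n + 1)) (wallaceOutputs n + 1)

/-- The inequality-constraints `E`: `e i` says that the two circuits differ in output bit `i`,
and some `e i` is true. -/
noncomputable def inequality (n : ℕ) : CNF DistVar :=
  (⋃ i < numOut n, constrain (e i) (BExpr.xor (outL n i) (outR n i))) ∪
  {(Finset.range (numOut n)).image fun i => (e i, true)}

end DistVar

/-- The CNF formula stating that the Wallace tree circuits for `x (y + z)` and `x y + x z`
disagree on some output bit for some `n`-bit inputs `x`, `y`, `z`. -/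
noncomputable def wallaceDist (n : ℕ) : CNF DistVar :=
  DistVar.circuitL n ∪ DistVar.circuitR n ∪ DistVar.inequality n

/-! A read-once branching program that finds a falsified clause becomes, when read from its leaves
to its root, a regular resolution refutation with one line per level and node
(`BranchingProgram.exists_refutation`). So it suffices to find a falsified clause while remembering
`O(log² n)` bits. The program first queries the comparison bits `e i` and keeps only the index `k`
of the first true one; if none is true, the clause `⋁ e i` is falsified. After that it looks only at
a strip of columns `k₀, …, k` with `k - k₀` about `2 log n` (or with `k₀ = 0`).

Arithmetic. Give column `k₀ + d` the weight `2 ^ d`. An adder preserves weighted sums, so carries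
between columns of the strip telescope (`sum_two_pow_carry`). What remains are the carries into
column `k₀`, and the carries out of column `k`, which vanish modulo `2 ^ (k - k₀ + 1)`. The same
telescoping proves the distributive law: the identity `s_j - y_j - z_j = C_j - 2 C_{j+1}` of the
adder for `y + z` is convolved with `x`. The outputs agree below column `k` and differ in it, so an
odd multiple of `2 ^ (k - k₀)` would equal the net incoming carry. That carry is only polynomial in
`n` and hence too small, or zero if `k₀ = 0` (`DistVar.DistStrip.false`).

Memory. A strip has too many variables to be remembered at once, because its columns have height up
to about `n`. Therefore every variable gets an interval of times such that the variables of each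
needed constraint share a time; sweeping by left endpoints, one remembers only the variables that
are live at one time (`exists_sweep`, `exists_refutation_of_pathwidth`). Adder `j` of a layer reads
the positions `3j, 3j + 1, 3j + 2` and writes close to position `2j` of the next layer, since
neighbouring columns have almost equal height. With the time scale `layerUnit` all layers can thus
be swept simultaneously, with at most nine live positions per column and layer, and there are `O(log
n)` columns and `O(log n)` layers. Windows of `O(log n)` bits of `x`, `y`, `z` and `y + z` slide
along. The final adders contribute `O(log n)` variables per column, all at time `0`. The total is
`O(log² n)` live variables. -/

/-! ### Read-once branching programs -/

/-- The assignment `σ` falsifies the clause `C`. -/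
def Falsifies {V : Type} (σ : V → Bool) (C : Clause V) : Prop := ∀ l ∈ C, σ l.1 ≠ l.2

/-- A levelled read-once branching program for the search problem of the CNF formula `F`:
`state t σ` is the node that the assignment `σ` reaches at level `t`, and `query t s` is the
variable queried there (if any). Every assignment reaches a node at which some clause of `F` is
falsified by all assignments that reach it. -/
structure BranchingProgram {V : Type} [DecidableEq V] (F : CNF V) (S : Type) where
  depth : ℕ
  state : ℕ → (V → Bool) → S
  query : ℕ → S → Option V
  start : ∀ σ σ', state 0 σ = state 0 σ'
  step : ∀ t σ σ', state t σ = state t σ' →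
    (∀ x, query t (state t σ) = some x → σ x = σ' x) → state (t + 1) σ = state (t + 1) σ'
  read_once : ∀ σ t t' x, t < t' → query t (state t σ) = some x →
    query t' (state t' σ) ≠ some x
  ends : ∀ σ, ∃ t < depth, ∃ C ∈ F, ∀ σ', state t σ' = state t σ → Falsifies σ' C

namespace BranchingProgram

variable {V : Type} [DecidableEq V] {F : CNF V} {S : Type} (P : BranchingProgram F S)

/-- The variable queried at level `t` was not queried before, so its value cannot have influenced
the history. Thus an assignment that reaches a node can be steered into either successor. -/
theorem state_update {σ : V → Bool} {t : ℕ} {x : V} (hx : P.query t (P.state t σ) = some x)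
    (b : Bool) : ∀ t' ≤ t, P.state t' (Function.update σ x b) = P.state t' σ := by
  intro t'
  induction t' with
  | zero => intro _; exact P.start _ _
  | succ t' ih =>
    intro h
    have h1 := ih (by omega)
    refine (P.step t' σ _ h1.symm ?_).symm
    intro y hy
    have : y ≠ x := by
      rintro rfl
      exact P.read_once σ t' t y (by omega) hy hx
    simp [this]

/-- The clause is falsified at the node `s` of level `t`. -/
def IsLeafClause (t : ℕ) (s : S) (C : Clause V) : Prop :=
  C ∈ F ∧ ∀ σ, P.state t σ = s → Falsifies σ C

open Classical in
/-- The node of level `t + 1` that follows `s` if the queried variable has the value `b`. -/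
noncomputable def next (t : ℕ) (s : S) (b : Bool) : S :=
  if h : ∃ σ, P.state t σ = s ∧ ∀ x, P.query t s = some x → σ x = b then
    P.state (t + 1) h.choose
  else s

theorem next_eq {t : ℕ} {s : S} {b : Bool} {σ : V → Bool} (hs : P.state t σ = s)
    (hb : ∀ x, P.query t s = some x → σ x = b) : P.next t s b = P.state (t + 1) σ := by
  have h : ∃ σ, P.state t σ = s ∧ ∀ x, P.query t s = some x → σ x = b := ⟨σ, hs, hb⟩
  rw [next, dif_pos h]
  refine P.step t _ _ (h.choose_spec.1.trans hs.symm) ?_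
  intro x hx
  rw [h.choose_spec.1] at hx
  rw [h.choose_spec.2 x hx, hb x hx]

open Classical in
/-- The line of the refutation that belongs to the node `s` of level `depth - r`; `C₀` is any
clause of `F`. -/
noncomputable def line (C₀ : Clause V) : ℕ → S → Clause V × Option (V × (ℕ × S) × (ℕ × S))
  | 0, _ => (C₀, none)
  | r + 1, s =>
    let t := P.depth - (r + 1)
    if ∃ σ, P.state t σ = s then
      if h : ∃ C, P.IsLeafClause t s C then (h.choose, none)
      else
        let d := line C₀ r (P.next t s true)
        let d' := line C₀ r (P.next t s false)
        match P.query t s with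
        | none => d
        | some x =>
          -- If a child's clause does not mention `x` with the polarity to be resolved away, that
          -- clause already serves this node. The child's line is then copied together with its
          -- rule, so premises may lie several levels deeper.
          if (x, true) ∈ d'.1 then
            if (x, false) ∈ d.1 then
              (d'.1.erase (x, true) ∪ d.1.erase (x, false),
                some (x, (r, P.next t s false), (r, P.next t s true)))
            else d
          else d'
    else (C₀, none)

variable {P} {C₀ : Clause V}

theorem line_input (hC₀ : C₀ ∈ F) (r : ℕ) (s : S) (h : (P.line C₀ r s).2 = none) :
    (P.line C₀ r s).1 ∈ F := by
  induction r generalizing s with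
  | zero => exact hC₀
  | succ r ih =>
    rw [line] at h ⊢
    split_ifs at h ⊢ with h1 h2
    · exact h2.choose_spec.1
    · cases hq : P.query (P.depth - (r + 1)) s with
      | none => simp only [hq] at h ⊢; exact ih _ h
      | some x =>
        simp only [hq] at h ⊢
        split_ifs at h ⊢
        · exact ih _ h
        · exact ih _ h
    · exact hC₀

theorem line_resolve (r : ℕ) (s : S) {x : V} {i j : ℕ × S}
    (h : (P.line C₀ r s).2 = some (x, i, j)) :
    i.1 < r ∧ j.1 < r ∧ (x, true) ∈ (P.line C₀ i.1 i.2).1 ∧ (x, false) ∈ (P.line C₀ j.1 j.2).1 ∧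
      (P.line C₀ r s).1 =
        (P.line C₀ i.1 i.2).1.erase (x, true) ∪ (P.line C₀ j.1 j.2).1.erase (x, false) := by
  induction r generalizing s with
  | zero => simp [line] at h
  | succ r ih =>
    have lift : ∀ s', (P.line C₀ r s').2 = some (x, i, j) →
        i.1 < r + 1 ∧ j.1 < r + 1 ∧ (x, true) ∈ (P.line C₀ i.1 i.2).1 ∧
        (x, false) ∈ (P.line C₀ j.1 j.2).1 ∧ (P.line C₀ r s').1 =
        (P.line C₀ i.1 i.2).1.erase (x, true) ∪ (P.line C₀ j.1 j.2).1.erase (x, false) := by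
      intro s' h'
      obtain ⟨h1, h2, h3⟩ := ih s' h'
      exact ⟨by omega, by omega, h3⟩
    rw [line] at h
    rw [show P.line C₀ (r + 1) s = _ from rfl, line]
    split_ifs at h ⊢ with h1 h2
    cases hq : P.query (P.depth - (r + 1)) s with
    | none => simp only [hq] at h ⊢; exact lift _ h
    | some y =>
      simp only [hq] at h ⊢
      split_ifs at h ⊢ with h3 h4
      · simp only [Option.some.injEq, Prod.mk.injEq] at h
        obtain ⟨rfl, rfl, rfl⟩ := h
        exact ⟨by simp, by simp, h3, h4, rfl⟩
      · exact lift _ h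
      · exact lift _ h

theorem line_reachable (r : ℕ) (s : S) {ρ : V × (ℕ × S) × (ℕ × S)}
    (h : (P.line C₀ r s).2 = some ρ) : ∃ σ, P.state (P.depth - r) σ = s := by
  cases r with
  | zero => simp [line] at h
  | succ r =>
    by_contra h1
    rw [line, if_neg h1] at h
    simp at h

/-- This is the invariant of the translation. Assignments that have already passed a leaf are
excluded, because below a leaf the lines carry no information; in particular level `depth` is never
reached by the others. -/
theorem line_falsified (r : ℕ) (hr : r ≤ P.depth) (σ : V → Bool)
    (hσ : ∀ t < P.depth - r, ¬ ∃ C, P.IsLeafClause t (P.state t σ) C) :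
    Falsifies σ (P.line C₀ r (P.state (P.depth - r) σ)).1 := by
  induction r generalizing σ with
  | zero =>
    obtain ⟨t, ht, C, hC, h⟩ := P.ends σ
    exact absurd ⟨C, hC, h⟩ (hσ t (by simpa using ht))
  | succ r ih =>
    rw [line]
    set t := P.depth - (r + 1) with ht
    have ht' : P.depth - r = t + 1 := by omega
    rw [if_pos ⟨σ, rfl⟩]
    split_ifs with h2
    · exact h2.choose_spec.2 _ rfl
    -- Leaves depend only on the states visited, so an assignment with the same history has not met
    -- one either.
    have alive : ∀ σ', (∀ t' ≤ t, P.state t' σ' = P.state t' σ) →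
        Falsifies σ' (P.line C₀ r (P.state (t + 1) σ')).1 := by
      intro σ' h
      have := ih (by omega) σ' (by
        intro t' h'
        rw [h t' (by omega)]
        rcases Nat.lt_or_ge t' t with h3 | h3
        · exact hσ t' (by omega)
        · obtain rfl : t' = t := by omega
          exact h2)
      rwa [ht'] at this
    cases hq : P.query t (P.state t σ) with
    | none =>
      dsimp only
      rw [P.next_eq rfl (by simp [hq])]
      exact alive σ (by simp)
    | some x =>
      have key : ∀ b, Falsifies (Function.update σ x b)
          (P.line C₀ r (P.next t (P.state t σ) b)).1 := by
        intro b
        have h3 := P.state_update hq b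
        rw [P.next_eq (σ := Function.update σ x b) (h3 t le_rfl) (by
          intro y hy; rw [hq] at hy; cases hy; simp)]
        exact alive _ h3
      have aux : ∀ b, ∀ l ∈ (P.line C₀ r (P.next t (P.state t σ) b)).1,
          l ≠ (x, !b) → σ l.1 ≠ l.2 := by
        intro b l hl hne
        have h4 := key b l hl
        by_cases h5 : l.1 = x
        · rw [h5, Function.update_self] at h4
          exact absurd (Prod.ext h5 (by simpa using (Bool.eq_not_of_ne h4.symm))) hne
        · rwa [Function.update_of_ne h5] at h4
      dsimp only
      split_ifs with h3 h4
      · intro l hl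
        rw [Finset.mem_union, Finset.mem_erase, Finset.mem_erase] at hl
        rcases hl with hl | hl
        · exact aux false l hl.2 hl.1
        · exact aux true l hl.2 hl.1
      · intro l hl
        exact aux true l hl (by rintro rfl; exact h4 hl)
      · intro l hl
        exact aux false l hl (by rintro rfl; exact h3 hl)

/-- An edge of the proof DAG is realised by a computation: some assignment keeps the history of `σ`,
queries the resolved variable at a level `t`, and then arrives at the premise. Because of copied
lines, `t` may be later than the level of the node itself. -/
theorem line_trace (r : ℕ) (hr : r ≤ P.depth) {x : V} {i j : ℕ × S} (σ : V → Bool)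
    (h : (P.line C₀ r (P.state (P.depth - r) σ)).2 = some (x, i, j)) {c : ℕ × S}
    (hc : c = i ∨ c = j) :
    ∃ σ' t, (∀ t' ≤ P.depth - r, P.state t' σ' = P.state t' σ) ∧ P.depth - r ≤ t ∧
      t < P.depth - c.1 ∧ P.query t (P.state t σ') = some x ∧
      P.state (P.depth - c.1) σ' = c.2 := by
  induction r generalizing σ with
  | zero => simp [line] at h
  | succ r ih =>
    rw [line] at h
    set t := P.depth - (r + 1) with ht
    have ht' : P.depth - r = t + 1 := by omega
    split_ifs at h with h1 h2
    have lift : ∀ σ', (∀ t' ≤ t, P.state t' σ' = P.state t' σ) →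
        (P.line C₀ r (P.state (t + 1) σ')).2 = some (x, i, j) →
        ∃ σ' u, (∀ t' ≤ t, P.state t' σ' = P.state t' σ) ∧ t ≤ u ∧
          u < P.depth - c.1 ∧ P.query u (P.state u σ') = some x ∧
          P.state (P.depth - c.1) σ' = c.2 := by
      intro σ' h3 h4
      rw [← ht'] at h4
      obtain ⟨σ'', u, h5, h6, h7⟩ := ih (by omega) σ' h4
      exact ⟨σ'', u, fun t' h => (h5 t' (by omega)).trans (h3 t' h), by omega, h7⟩
    cases hq : P.query t (P.state t σ) with
    | none =>
      simp only [hq] at h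
      rw [P.next_eq rfl (by simp [hq])] at h
      exact lift σ (by simp) h
    | some y =>
      have key : ∀ b, P.next t (P.state t σ) b = P.state (t + 1) (Function.update σ y b) := by
        intro b
        exact P.next_eq (P.state_update hq b t le_rfl) (by
          intro z hz; rw [hq] at hz; cases hz; simp)
      simp only [hq] at h
      split_ifs at h with h3 h4
      · simp only [Option.some.injEq, Prod.mk.injEq] at h
        obtain ⟨rfl, hi, hj⟩ := h
        obtain ⟨b, rfl⟩ : ∃ b, c = (r, P.next t (P.state t σ) b) := by
          rcases hc with rfl | rfl
          · exact ⟨false, hi.symm⟩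
          · exact ⟨true, hj.symm⟩
        refine ⟨Function.update σ y b, t, P.state_update hq b, le_rfl, by dsimp only; omega, ?_, ?_⟩
        · rw [P.state_update hq b t le_rfl, hq]
        · dsimp only; rw [ht', key]
      · rw [key] at h
        exact lift _ (P.state_update hq true) h
      · rw [key] at h
        exact lift _ (P.state_update hq false) h

/-- Lines are ordered by their distance from the bottom level, so premises come first. Regularity
holds since a path of the proof is followed by a single computation, which queries no variable
twice. -/
theorem exists_refutation [Fintype S] (P : BranchingProgram F S) :
    ∃ π : ResolutionRefutation F,
      π.IsRegular ∧ π.size = P.depth * Fintype.card S + 1 := by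
  classical
  set σ₀ : V → Bool := fun _ => false
  set s₀ := P.state 0 σ₀ with hs₀
  obtain ⟨C₀, hC₀⟩ : ∃ C₀, C₀ ∈ F := by
    obtain ⟨_, _, C, hC, _⟩ := P.ends σ₀
    exact ⟨C, hC⟩
  set M := Fintype.card S with hM
  have hM0 : 0 < M := Fintype.card_pos_iff.2 ⟨s₀⟩
  -- The start node gets number `0`, so that its line, the empty clause, is the last line, with
  -- index `depth * M`.
  obtain ⟨e, he⟩ : ∃ e : S ≃ Fin M, e s₀ = ⟨0, hM0⟩ :=
    ⟨(Fintype.equivFin S).trans (Equiv.swap (Fintype.equivFin S s₀) ⟨0, hM0⟩), by simp⟩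
  set dec : ℕ → ℕ × S := fun k => (k / M, e.symm ⟨k % M, Nat.mod_lt _ hM0⟩) with hdec
  set enc : ℕ × S → ℕ := fun c => c.1 * M + (e c.2 : ℕ) with henc
  have dec_enc : ∀ c, dec (enc c) = c := by
    rintro ⟨r, s⟩
    have hlt := (e s).2
    simp only [hdec, henc]
    refine Prod.ext ?_ ?_
    · simp [Nat.add_div_of_dvd_right, Nat.div_eq_of_lt hlt, hM0, mul_comm r M]
    · simp only [Equiv.symm_apply_eq]
      ext
      simp [mul_comm r M, Nat.mod_eq_of_lt hlt]
  have enc_lt : ∀ c k, c.1 < (dec k).1 → enc c < k := by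
    intro c k h
    have h1 : (c.1 + 1) * M ≤ k / M * M := Nat.mul_le_mul_right _ h
    have h2 := Nat.div_mul_le_self k M
    have h3 := (e c.2).2
    simp only [henc]
    nlinarith
  have dec_le : ∀ k < P.depth * M + 1, (dec k).1 ≤ P.depth := by
    intro k hk
    exact Nat.div_le_of_le_mul (by rw [mul_comm]; omega)
  set ln : ℕ → Clause V × Option (V × (ℕ × S) × (ℕ × S)) :=
    fun k => P.line C₀ (dec k).1 (dec k).2 with hln
  have lt_size : ∀ (k : Fin (P.depth * M + 1)) x i j, (ln k).2 = some (x, i, j) →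
      enc i < k ∧ enc j < k := by
    intro k x i j h
    obtain ⟨h1, h2, -⟩ := line_resolve _ _ h
    exact ⟨enc_lt _ _ h1, enc_lt _ _ h2⟩
  -- The reduction modulo the size has no effect on premises, whose indices are smaller than that of
  -- their line.
  set toFin : ℕ → Fin (P.depth * M + 1) := fun k => Fin.ofNat _ k
  have toFin_val : ∀ (k : Fin (P.depth * M + 1)) m, m < k.val → (toFin m).val = m := by
    intro k m h
    exact Nat.mod_eq_of_lt (h.trans k.2)
  have rule_some : ∀ (k : Fin (P.depth * M + 1)) x i j,
      (ln k).2.map (fun ρ => (ρ.1, toFin (enc ρ.2.1), toFin (enc ρ.2.2))) = some (x, i, j) →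
      ∃ i' j', (ln k).2 = some (x, i', j') ∧ i.val = enc i' ∧ j.val = enc j' := by
    intro k x i j h
    rw [Option.map_eq_some_iff] at h
    obtain ⟨⟨x', i', j'⟩, h1, h2⟩ := h
    simp only [Prod.mk.injEq] at h2
    obtain ⟨rfl, rfl, rfl⟩ := h2
    obtain ⟨h3, h4⟩ := lt_size _ _ _ _ h1
    exact ⟨i', j', h1, toFin_val k _ h3, toFin_val k _ h4⟩
  have ln_enc : ∀ c, ln (enc c) = P.line C₀ c.1 c.2 := by
    intro c; simp only [hln, dec_enc]
  refine ⟨{ size := P.depth * M + 1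
            clause := fun k => (ln k).1
            rule := fun k => (ln k).2.map fun ρ => (ρ.1, toFin (enc ρ.2.1), toFin (enc ρ.2.2))
            input_mem := ?_
            resolve := ?_
            ends_empty := ?_ }, ?_, rfl⟩
  · intro k hk
    exact line_input hC₀ _ _ (by simpa using hk)
  · intro k x i j h
    obtain ⟨i', j', h1, hi, hj⟩ := rule_some k x i j h
    obtain ⟨h2, h3⟩ := lt_size _ _ _ _ h1
    obtain ⟨-, -, h4⟩ := line_resolve _ _ h1
    rw [← ln_enc, ← ln_enc, ← hi, ← hj] at h4
    exact ⟨Fin.lt_def.2 (by omega), Fin.lt_def.2 (by omega), h4⟩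
  · have h0 : enc (P.depth, s₀) = P.depth * M := by simp [henc, he]
    refine ⟨⟨P.depth * M, by omega⟩, rfl, ?_⟩
    change (ln (P.depth * M)).1 = ∅
    rw [← h0, ln_enc]
    refine Finset.eq_empty_of_forall_notMem fun l hl => ?_
    -- A constant assignment with the polarity of `l` satisfies `l`, while every assignment
    -- falsifies the clause of the root.
    have h1 := line_falsified (P := P) (C₀ := C₀) P.depth le_rfl (fun _ => l.2) (by simp)
    rw [Nat.sub_self, P.start _ σ₀] at h1
    exact h1 l hl rfl
  · intro a b hab x hax hbx
    have edge : ∀ (a b : Fin (P.depth * M + 1)) (σ : V → Bool) y i j,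
        P.state (P.depth - (dec a).1) σ = (dec a).2 →
        (ln a).2.map (fun ρ => (ρ.1, toFin (enc ρ.2.1), toFin (enc ρ.2.2))) = some (y, i, j) →
        (b = i ∨ b = j) →
        ∃ σ' t, (∀ t' ≤ P.depth - (dec a).1, P.state t' σ' = P.state t' σ) ∧
          P.depth - (dec a).1 ≤ t ∧ t < P.depth - (dec b).1 ∧
          P.query t (P.state t σ') = some y ∧ P.state (P.depth - (dec b).1) σ' = (dec b).2 := by
      intro a b σ y i j hσ h hb
      obtain ⟨i', j', h1, hi, hj⟩ := rule_some a y i j h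
      simp only [hln] at h1
      rw [← hσ] at h1
      refine line_trace _ (dec_le _ a.2) σ h1 ?_
      rcases hb with rfl | rfl
      · rw [hi, dec_enc]; exact Or.inl rfl
      · rw [hj, dec_enc]; exact Or.inr rfl
    -- Induction along the path of the proof: one assignment reaches the node of the current line
    -- and has queried `x` earlier.
    have trace : ∃ σ t, t < P.depth - (dec b).1 ∧ P.query t (P.state t σ) = some x ∧
        P.state (P.depth - (dec b).1) σ = (dec b).2 := by
      clear hbx
      induction hab with
      | single h =>
        obtain ⟨y, i, j, h1, h2⟩ := h
        obtain ⟨i', j', h3⟩ := hax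
        rw [h3] at h1
        cases h1
        obtain ⟨i'', j'', h5, -⟩ := rule_some _ _ _ _ h3
        obtain ⟨σ, hσ⟩ := line_reachable _ _ h5
        obtain ⟨σ', t, -, -, h6⟩ := edge _ _ σ _ _ _ hσ h3 h2
        exact ⟨σ', t, h6⟩
      | tail _ h ih =>
        obtain ⟨y, i, j, h1, h2⟩ := h
        obtain ⟨σ, t, ht, hq, hσ⟩ := ih
        obtain ⟨σ', t', h5, h6, h7, -, h8⟩ := edge _ _ σ _ _ _ hσ h1 h2
        refine ⟨σ', t, by omega, ?_, h8⟩
        rw [h5 t ht.le]; exact hq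
    obtain ⟨σ, t, ht, hq, hσ⟩ := trace
    obtain ⟨i, j, h1⟩ := hbx
    obtain ⟨σ', t', h5, h6, -, h7, -⟩ := edge b i σ _ _ _ hσ h1 (Or.inl rfl)
    refine P.read_once σ' t t' x (by omega) ?_ h7
    rw [h5 t ht.le]; exact hq

end BranchingProgram

/-! ### Formulas of small pathwidth -/

section Pathwidth

variable {V : Type}

theorem exists_sorted_enumeration [Inhabited V] (U : Finset V) (a : V → ℤ) :
    ∃ v : ℕ → V, Set.InjOn v {j | j < U.card} ∧ (∀ j < U.card, v j ∈ U) ∧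
      (∀ u ∈ U, ∃ j < U.card, v j = u) ∧ ∀ i j, i ≤ j → j < U.card → a (v i) ≤ a (v j) := by
  set e := U.equivFin.symm
  set f : Fin U.card → ℤ := fun i => a (e i)
  set p := Tuple.sort f
  have hp : Monotone (f ∘ p) := Tuple.monotone_sort f
  refine ⟨fun j => if h : j < U.card then e (p ⟨j, h⟩) else default, ?_, ?_, ?_, ?_⟩
  · intro i hi j hj h
    simp only [Set.mem_ofPred_eq] at hi hj
    simp only [dif_pos hi, dif_pos hj] at h
    simpa using p.injective (e.injective (Subtype.ext h))
  · intro j hj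
    simp only [dif_pos hj]
    exact (e _).2
  · intro u hu
    refine ⟨p.symm (e.symm ⟨u, hu⟩), Fin.isLt _, ?_⟩
    simp
  · intro i j hij hj
    simp only [dif_pos hj, dif_pos (hij.trans_lt hj)]
    exact hp (show (⟨i, _⟩ : Fin U.card) ≤ ⟨j, _⟩ from hij)

/-- The index of the first of the variables `e 0, …, e (m - 1)` that is true, or `N`. -/
def firstTrue (e : ℕ → V) (N : ℕ) : ℕ → (V → Bool) → ℕ
  | 0, _ => N
  | m + 1, σ => if firstTrue e N m σ < N then firstTrue e N m σ else if σ (e m) then m else N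

theorem firstTrue_le (e : ℕ → V) (N m : ℕ) (hm : m ≤ N) (σ : V → Bool) :
    firstTrue e N m σ ≤ N := by
  induction m with
  | zero => exact le_rfl
  | succ m ih => rw [firstTrue]; split_ifs <;> omega

theorem firstTrue_eq (e : ℕ → V) (N m : ℕ) (σ : V → Bool) (h : N ≤ firstTrue e N m σ) :
    ∀ i < m, i < N → σ (e i) = false := by
  induction m with
  | zero => simp
  | succ m ih =>
    intro i hi hiN
    rw [firstTrue] at h
    split_ifs at h with h1 h2
    · omega
    · rcases Nat.lt_succ_iff_lt_or_eq.1 hi with h3 | rfl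
      · exact ih (by omega) i h3 hiN
      · omega
    · rcases Nat.lt_succ_iff_lt_or_eq.1 hi with h3 | rfl
      · exact ih (by omega) i h3 hiN
      · simpa using h2

theorem firstTrue_lt (e : ℕ → V) (N m : ℕ) (σ : V → Bool) (h : firstTrue e N m σ < N) :
    firstTrue e N m σ < m ∧ σ (e (firstTrue e N m σ)) = true ∧
      ∀ i < firstTrue e N m σ, σ (e i) = false := by
  induction m with
  | zero => simp [firstTrue] at h
  | succ m ih =>
    rw [firstTrue] at h ⊢
    split_ifs at h ⊢ with h1 h2
    · obtain ⟨h3, h4⟩ := ih h1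
      exact ⟨by omega, h4⟩
    · exact ⟨by omega, h2, fun i hi => firstTrue_eq e N m σ (by omega) i hi (by omega)⟩
    · omega

variable [DecidableEq V]

/-- Sweeping over variables that live on intervals: the variables can be ordered such that one
needs to remember only the values of sets `bag s` of at most `w` variables. -/
theorem exists_sweep [Inhabited V] (U : Finset V) (a b : V → ℤ) (w : ℕ)
    (hw : ∀ τ, (U.filter fun v => a v ≤ τ ∧ τ ≤ b v).card ≤ w) :
    ∃ (v : ℕ → V) (bag : ℕ → Finset V), Set.InjOn v {j | j < U.card} ∧
      (∀ j < U.card, v j ∈ U) ∧ bag 0 = ∅ ∧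
      (∀ s < U.card, bag (s + 1) ⊆ insert (v s) (bag s)) ∧
      (∀ s, U.card ≤ s → bag (s + 1) = ∅) ∧ (∀ s, (bag s).card ≤ w) ∧
      ∀ X ⊆ U, (∃ τ, ∀ u ∈ X, a u ≤ τ ∧ τ ≤ b u) → ∃ s ≤ U.card, X ⊆ bag s := by
  obtain ⟨v, hinj, hmem, hsurj, hmono⟩ := exists_sorted_enumeration U a
  -- After reading `v s`, keep those variables read so far whose interval contains the left endpoint
  -- `a (v s)`; these are all live at one time, which bounds the bag by `w`.
  set bag : ℕ → Finset V := fun s => Nat.casesOn s ∅ fun s =>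
    if s < U.card then ((Finset.range (s + 1)).image v).filter fun u => a (v s) ≤ b u else ∅
    with hbag
  have hbag' : ∀ s < U.card, bag (s + 1) =
      ((Finset.range (s + 1)).image v).filter fun u => a (v s) ≤ b u := by
    intro s hs
    simp [hbag, hs]
  have hempty : ∀ s, U.card ≤ s → bag (s + 1) = ∅ := by
    intro s hs
    simp [hbag, Nat.not_lt.2 hs]
  refine ⟨v, bag, hinj, hmem, rfl, ?_, hempty, ?_, ?_⟩
  · intro s hs u hu
    rw [hbag' s hs, Finset.mem_filter, Finset.mem_image] at hu
    obtain ⟨⟨j, hj, rfl⟩, hb⟩ := hu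
    rw [Finset.mem_range] at hj
    rw [Finset.mem_insert]
    rcases Nat.lt_succ_iff_lt_or_eq.1 hj with h | rfl
    · obtain ⟨s, rfl⟩ : ∃ m, s = m + 1 := ⟨s - 1, by omega⟩
      refine Or.inr ?_
      rw [hbag' s (by omega), Finset.mem_filter]
      exact ⟨Finset.mem_image_of_mem _ (Finset.mem_range.2 h),
        (hmono _ _ (Nat.le_succ s) hs).trans hb⟩
    · exact Or.inl rfl
  · intro s
    rcases s with _ | s
    · simp [hbag]
    rcases Nat.lt_or_ge s U.card with hs | hs
    · refine le_trans (Finset.card_le_card ?_) (hw (a (v s)))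
      rw [hbag' s hs]
      intro u hu
      rw [Finset.mem_filter, Finset.mem_image] at hu
      obtain ⟨⟨j, hj, rfl⟩, hb⟩ := hu
      rw [Finset.mem_range] at hj
      rw [Finset.mem_filter]
      exact ⟨hmem _ (by omega), hmono _ _ (by omega) hs, hb⟩
    · simp [hempty s hs]
  · rintro X hX ⟨τ, hτ⟩
    rcases X.eq_empty_or_nonempty with rfl | hne
    · exact ⟨0, Nat.zero_le _, by simp⟩
    -- Take the variable of `X` that is read last. Its left endpoint is at most `τ` and at least
    -- every other left endpoint, so it lies in all intervals of `X`.
    set J := (Finset.range U.card).filter fun j => v j ∈ X with hJ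
    have hJne : J.Nonempty := by
      obtain ⟨u, hu⟩ := hne
      obtain ⟨j, hj, rfl⟩ := hsurj u (hX hu)
      exact ⟨j, by simp [hJ, hj, hu]⟩
    have hs := J.max'_mem hJne
    set s := J.max' hJne
    simp only [hJ, Finset.mem_filter, Finset.mem_range] at hs
    refine ⟨s + 1, hs.1, fun u hu => ?_⟩
    obtain ⟨j, hj, rfl⟩ := hsurj u (hX hu)
    have hjs : j ≤ s := J.le_max' j (by simp [hJ, hj, hu])
    rw [hbag' s hs.1, Finset.mem_filter]
    exact ⟨Finset.mem_image_of_mem _ (Finset.mem_range.2 (by omega)),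
      (hτ _ hs.2).1.trans (hτ _ hu).2⟩

/-- If `F` contains the clause `e 0 ∨ ⋯ ∨ e (N - 1)`, and if for every `k < N` the constraints
that are refuted in the case that `e k` is the first true one have a path decomposition of width
`w` (apart from the variables `e i`), then `F` has regular refutations of size `2 ^ O(w)`. -/
theorem exists_refutation_of_pathwidth {F : CNF V} (N : ℕ) (e : ℕ → V)
    (he : Function.Injective e) (hF : (Finset.range N).image (fun i => (e i, true)) ∈ F)
    (w T : ℕ) (U : ℕ → Finset V) (a b : ℕ → V → ℤ)
    (hU : ∀ k < N, ∀ i, e i ∉ U k) (hT : ∀ k < N, (U k).card ≤ T)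
    (hw : ∀ k < N, ∀ τ, ((U k).filter fun v => a k v ≤ τ ∧ τ ≤ b k v).card ≤ w)
    (hviol : ∀ k < N, ∀ σ : V → Bool, (∀ i < k, σ (e i) = false) → σ (e k) = true →
      ∃ C ∈ F, Falsifies σ C ∧ ∃ τ, ∀ l ∈ C, (∃ i ≤ k, l.1 = e i) ∨
        (l.1 ∈ U k ∧ a k l.1 ≤ τ ∧ τ ≤ b k l.1)) :
    ∃ π : ResolutionRefutation F, π.IsRegular ∧
      π.size = (N + T + 1) * ((N + 1) * 2 ^ w) + 1 := by
  classical
  have : Inhabited V := ⟨e 0⟩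
  have sweep : ∀ k, ∃ (v : ℕ → V) (bag : ℕ → Finset V), k < N →
      Set.InjOn v {j | j < (U k).card} ∧ (∀ j < (U k).card, v j ∈ U k) ∧ bag 0 = ∅ ∧
      (∀ s < (U k).card, bag (s + 1) ⊆ insert (v s) (bag s)) ∧
      (∀ s, (U k).card ≤ s → bag (s + 1) = ∅) ∧ (∀ s, (bag s).card ≤ w) ∧
      ∀ X ⊆ U k, (∃ τ, ∀ u ∈ X, a k u ≤ τ ∧ τ ≤ b k u) → ∃ s ≤ (U k).card, X ⊆ bag s := by
    intro k
    by_cases hk : k < N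
    · obtain ⟨v, bag, h⟩ := exists_sweep (U k) (a k) (b k) w (hw k hk)
      exact ⟨v, bag, fun _ => h⟩
    · exact ⟨fun _ => e 0, fun _ => ∅, fun h => absurd h hk⟩
  choose v bag hsweep using sweep
  -- the values of the variables in a bag, as a vector of length `w`
  set win : ℕ → ℕ → (V → Bool) → Fin w → Bool := fun k s σ j =>
    if k < N then ((bag k s).toList[(j : ℕ)]?).elim false σ else false with hwin
  have win_eq : ∀ k < N, ∀ s σ σ', win k s σ = win k s σ' ↔ ∀ u ∈ bag k s, σ u = σ' u := by
    intro k hk s σ σ'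
    constructor
    · intro h u hu
      obtain ⟨j, hj, hju⟩ := List.getElem_of_mem (Finset.mem_toList.2 hu)
      have hjw : j < w := by
        rw [Finset.length_toList] at hj
        exact hj.trans_le ((hsweep k hk).2.2.2.2.2.1 s)
      have := congrFun h ⟨j, hjw⟩
      simpa [hwin, hk, List.getElem?_eq_getElem hj, hju] using this
    · intro h
      funext j
      simp only [hwin, if_pos hk]
      cases hj : (bag k s).toList[(j : ℕ)]? with
      | none => rfl
      | some u => exact h u (Finset.mem_toList.1 (List.mem_of_getElem? hj))
  -- From level `N` on, `κ` is constant and selects the sweep to be carried out. Before that no bag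
  -- is stored, since `bag k 0` is empty.
  set κ : ℕ → (V → Bool) → ℕ := fun t σ => firstTrue e N (min t N) σ with hκ
  have κ_lt : ∀ t σ, κ t σ < N + 1 := fun t σ =>
    Nat.lt_succ_of_le (firstTrue_le e N _ (min_le_right _ _) σ)
  set state : ℕ → (V → Bool) → Fin (N + 1) × (Fin w → Bool) := fun t σ =>
    (⟨κ t σ, κ_lt t σ⟩, win (κ t σ) (t - N) σ) with hstate
  set query : ℕ → Fin (N + 1) × (Fin w → Bool) → Option V := fun t s =>
    if t < N then some (e t) else
      if (s.1 : ℕ) < N ∧ t - N < (U s.1).card then some (v s.1 (t - N)) else none with hquery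
  have state_eq : ∀ t σ σ', state t σ = state t σ' ↔
      κ t σ = κ t σ' ∧ (κ t σ < N → ∀ u ∈ bag (κ t σ) (t - N), σ u = σ' u) := by
    intro t σ σ'
    simp only [hstate, Prod.mk.injEq, Fin.mk.injEq]
    constructor
    · rintro ⟨h1, h2⟩
      refine ⟨h1, fun h3 => ?_⟩
      rw [← h1] at h2
      exact (win_eq _ h3 _ _ _).1 h2
    · rintro ⟨h1, h2⟩
      refine ⟨h1, ?_⟩
      rw [← h1]
      by_cases h3 : κ t σ < N
      · exact (win_eq _ h3 _ _ _).2 (h2 h3)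
      · funext j; simp only [hwin, if_neg h3]
  have bag_zero : ∀ k < N, bag k 0 = ∅ := fun k hk => (hsweep k hk).2.2.1
  have κ_ge : ∀ t σ, N ≤ t → κ t σ = κ N σ := by
    intro t σ ht
    simp [hκ, min_eq_right ht]
  let P : BranchingProgram F (Fin (N + 1) × (Fin w → Bool)) :=
    { depth := N + T + 1
      state := state
      query := query
      start := ?_
      step := ?_
      read_once := ?_
      ends := ?_ }
  · obtain ⟨π, hπ, hsize⟩ := P.exists_refutation
    refine ⟨π, hπ, hsize.trans ?_⟩
    simp [P]
  · intro σ σ'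
    rw [state_eq]
    have h0 : ∀ σ, κ 0 σ = N := by intro σ; simp [hκ, firstTrue]
    simp [h0]
  · intro t σ σ' h hq
    rw [state_eq] at h ⊢
    obtain ⟨h1, h2⟩ := h
    rcases Nat.lt_or_ge t N with ht | ht
    · have h3 : σ (e t) = σ' (e t) := hq _ (by simp [hquery, ht])
      refine ⟨?_, fun h => ?_⟩
      · simp only [hκ, min_eq_left ht.le] at h1
        simp only [hκ, min_eq_left (show t + 1 ≤ N from ht), firstTrue, h1, h3]
      · rw [show t + 1 - N = 0 by omega, bag_zero _ h]
        simp
    · rw [κ_ge _ _ ht, κ_ge _ _ ht] at h1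
      rw [κ_ge _ _ ht] at h2
      rw [κ_ge (t + 1) σ (by omega), κ_ge (t + 1) σ' (by omega)]
      refine ⟨h1, fun hk u hu => ?_⟩
      rw [show t + 1 - N = (t - N) + 1 by omega] at hu
      obtain ⟨-, -, -, h4, h5, -⟩ := hsweep _ hk
      rcases Nat.lt_or_ge (t - N) (U (κ N σ)).card with hs | hs
      · rcases Finset.mem_insert.1 (h4 _ hs hu) with rfl | h6
        · refine hq _ ?_
          simp only [hquery, if_neg (Nat.not_lt.2 ht), hstate, κ_ge _ σ ht]
          rw [if_pos ⟨hk, hs⟩]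
        · exact h2 hk u h6
      · rw [h5 _ hs] at hu
        simp at hu
  · intro σ t t' x htt' h h'
    simp only [hquery] at h h'
    by_cases ht' : t' < N
    · rw [if_pos ht'] at h'
      rw [if_pos (htt'.trans ht')] at h
      have := he (Option.some.inj (h.trans h'.symm))
      omega
    · rw [if_neg ht'] at h'
      split_ifs at h' with h3
      simp only [hstate, κ_ge _ σ (Nat.not_lt.1 ht')] at h' h3
      by_cases ht : t < N
      · rw [if_pos ht] at h
        have := (hsweep _ h3.1).2.1 _ h3.2
        rw [Option.some.inj (h'.trans h.symm)] at this
        exact hU _ h3.1 _ this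
      · rw [if_neg ht] at h
        split_ifs at h with h4
        simp only [hstate, κ_ge _ σ (Nat.not_lt.1 ht)] at h h4
        have := (hsweep _ h3.1).1 h4.2 h3.2 (Option.some.inj (h.trans h'.symm))
        omega
  · intro σ
    by_cases hk : κ N σ < N
    · have hk' := firstTrue_lt e N N σ (by simpa [hκ] using hk)
      have hκN : firstTrue e N N σ = κ N σ := by simp [hκ]
      rw [hκN] at hk'
      obtain ⟨C, hC, hfals, τ, hτ⟩ := hviol _ hk σ hk'.2.2 hk'.2.1
      obtain ⟨-, -, -, -, -, -, hX⟩ := hsweep _ hk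
      obtain ⟨s, hs, hXs⟩ := hX ((C.image Prod.fst).filter (· ∈ U (κ N σ)))
        (fun u hu => (Finset.mem_filter.1 hu).2) ⟨τ, by
          intro u hu
          simp only [Finset.mem_filter, Finset.mem_image] at hu
          obtain ⟨⟨l, hl, rfl⟩, hu⟩ := hu
          rcases hτ l hl with ⟨i, -, hi⟩ | h
          · rw [hi] at hu
            exact absurd hu (hU _ hk i)
          · exact h.2⟩
      refine ⟨N + s, by have := hT _ hk; omega, C, hC, fun σ' hσ' l hl => ?_⟩
      rw [eq_comm, state_eq, κ_ge _ σ (by omega), κ_ge _ σ' (by omega),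
        Nat.add_sub_cancel_left] at hσ'
      -- The state determines both kinds of variables of `C`: the index of the first true comparison
      -- bit fixes `e i` for all `i ≤ k`, and the bag holds the others.
      have hl' : σ l.1 = σ' l.1 := by
        rcases hτ l hl with ⟨i, hi, hli⟩ | h
        · have hk'' := firstTrue_lt e N N σ' (by
            have : κ N σ' < N := by rw [← hσ'.1]; exact hk
            simpa [hκ] using this)
          have hκN' : firstTrue e N N σ' = κ N σ := by rw [hσ'.1]; simp [hκ]
          rw [hκN'] at hk''
          rw [hli]
          rcases Nat.lt_or_eq_of_le hi with h3 | rfl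
          · rw [hk'.2.2 i h3, hk''.2.2 i h3]
          · rw [hk'.2.1, hk''.2.1]
        · exact hσ'.2 hk _ (hXs (Finset.mem_filter.2 ⟨Finset.mem_image_of_mem _ hl, h.1⟩))
      rw [← hl']
      exact hfals l hl
    -- No comparison bit is true, so the disjunction of all of them is falsified.
    · refine ⟨N, by omega, _, hF, fun σ' hσ' l hl => ?_⟩
      rw [state_eq] at hσ'
      have h1 : N ≤ firstTrue e N N σ' := by
        have : ¬ κ N σ' < N := by rw [hσ'.1]; exact hk
        simpa [hκ] using this
      obtain ⟨i, hi, rfl⟩ := Finset.mem_image.1 hl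
      rw [Finset.mem_range] at hi
      simp [firstTrue_eq e N N σ' h1 i hi hi]

end Pathwidth

/-! ### Arithmetic of the circuits in a strip of columns -/

/-- The value of a bit. -/
def bitVal (b : Bool) : ℤ := if b then 1 else 0

@[simp] theorem bitVal_false : bitVal false = 0 := rfl

@[simp] theorem bitVal_true : bitVal true = 1 := rfl

theorem bitVal_nonneg (b : Bool) : 0 ≤ bitVal b := by cases b <;> simp

theorem bitVal_le_one (b : Bool) : bitVal b ≤ 1 := by cases b <;> simp

theorem bitVal_and (a b : Bool) : bitVal (a && b) = bitVal a * bitVal b := by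
  cases a <;> cases b <;> rfl

theorem bitVal_adder {V : Type} (σ : V → Bool) (a b c : BExpr V) :
    bitVal (a.eval σ) + bitVal (b.eval σ) + bitVal (c.eval σ) =
      bitVal ((BExpr.sum3 a b c).eval σ) + 2 * bitVal ((BExpr.maj3 a b c).eval σ) := by
  simp only [BExpr.sum3, BExpr.maj3, BExpr.eval]
  cases a.eval σ <;> cases b.eval σ <;> cases c.eval σ <;> rfl

/-- A chain of local carry identities telescopes. -/
theorem sum_two_pow_carry (A F : ℕ → ℤ) (D : ℕ) (h : ∀ d < D, A d = F d - 2 * F (d + 1)) :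
    ∑ d ∈ Finset.range D, 2 ^ d * A d = F 0 - 2 ^ D * F D := by
  induction D with
  | zero => simp
  | succ D ih =>
    rw [Finset.sum_range_succ, ih fun d hd => h d (by omega), h D (by omega)]
    ring

theorem sum_range_groups (f : ℕ → ℤ) (h : ℕ) (hf : ∀ p, h ≤ p → f p = 0) :
    ∑ p ∈ Finset.range h, f p =
      ∑ j ∈ Finset.range ((h + 2) / 3), (f (3 * j) + f (3 * j + 1) + f (3 * j + 2)) := by
  have key : ∀ s, ∑ j ∈ Finset.range s, (f (3 * j) + f (3 * j + 1) + f (3 * j + 2)) =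
      ∑ p ∈ Finset.range (3 * s), f p := by
    intro s
    induction s with
    | zero => simp
    | succ s ih =>
      rw [Finset.sum_range_succ, ih, show 3 * (s + 1) = 3 * s + 1 + 1 + 1 by ring,
        Finset.sum_range_succ, Finset.sum_range_succ, Finset.sum_range_succ]
      ring
  rw [key]
  refine Finset.sum_subset (Finset.range_subset_range.2 (by omega)) fun p _ hp => ?_
  exact hf p (by simpa using hp)

/-- The positions at which the sum-bits and the carry-bits arrive fill a column. -/
theorem sum_range_interleave (f : ℕ → ℤ) (s c : ℕ) :
    ∑ q ∈ Finset.range (s + c), f q =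
      ∑ j ∈ Finset.range s, f (j + min j c) + ∑ j ∈ Finset.range c, f (min (j + 1) s + j) := by
  induction hN : s + c generalizing s c with
  | zero =>
    obtain ⟨rfl, rfl⟩ : s = 0 ∧ c = 0 := by omega
    simp
  | succ N ih =>
    rw [Finset.sum_range_succ]
    -- The last position `N` belongs to the last sum-bit if `c < s`, and to the last carry-bit
    -- otherwise.
    rcases Nat.lt_or_ge c s with h | h
    · obtain ⟨s, rfl⟩ : ∃ s', s = s' + 1 := ⟨s - 1, by omega⟩
      rw [ih s c (by omega), Finset.sum_range_succ, show s + min s c = N by omega]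
      have : ∀ j ∈ Finset.range c, f (min (j + 1) s + j) = f (min (j + 1) (s + 1) + j) := by
        intro j hj
        rw [Finset.mem_range] at hj
        congr 1; omega
      rw [Finset.sum_congr rfl this]
      ring
    · obtain ⟨c, rfl⟩ : ∃ c', c = c' + 1 := ⟨c - 1, by omega⟩
      rw [ih s c (by omega), Finset.sum_range_succ (fun j => f (min (j + 1) s + j)),
        show min (c + 1) s + c = N by omega]
      have : ∀ j ∈ Finset.range s, f (j + min j c) = f (j + min j (c + 1)) := by
        intro j hj
        rw [Finset.mem_range] at hj
        congr 1; omega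
      rw [Finset.sum_congr rfl this]
      ring

/-! ### Crude bounds on the dimensions of the tree -/

theorem lastLayer_spec (m i : ℕ) : colHeight m (lastLayer m) i ≤ 2 := by
  classical
  exact Nat.find_spec (exists_two_rows m) i

theorem lastLayer_le_of {m l : ℕ} (h : ∀ i, colHeight m l i ≤ 2) : lastLayer m ≤ l := by
  classical
  exact Nat.find_min' (exists_two_rows m) h

/-- This suffices for a polynomial bound on the carries that enter a strip. The memory bound needs
the logarithmic estimate `lastLayer_le_two_mul`. -/
theorem lastLayer_le (m : ℕ) : lastLayer m ≤ m :=
  lastLayer_le_of fun i => by have := colHeight_le m m i; omega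

theorem colHeight_finalWidth {m i : ℕ} (h : finalWidth m ≤ i) :
    colHeight m (lastLayer m) i = 0 := by
  classical
  exact Nat.find_spec (exists_width m) i h

theorem finalWidth_le (m : ℕ) : finalWidth m ≤ 3 * m := by
  classical
  refine Nat.find_min' (exists_width m) fun i hi => ?_
  have := lastLayer_le m
  exact colHeight_eq_zero m _ i (by omega)

theorem carryCount_le {m : ℕ} (hm : 1 ≤ m) (l i : ℕ) : carryCount m l i ≤ m := by
  cases i with
  | zero => simp [carryCount]
  | succ i =>
    have := colHeight_le m l i
    simp only [carryCount]
    omega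

/-! ### Carry-lookahead adder and Wallace tree multiplier in a strip -/

section Multiplier

variable {V : Type}

/-- The assignment `σ` satisfies those constraints of a carry-lookahead adder that are needed for
the columns `k₀, …, k`. -/
structure CLAStrip (W k₀ k : ℕ) (a b : ℕ → BExpr V) (ι : CLAVar → V) (σ : V → Bool) : Prop where
  init : k₀ = 0 → σ (ι (CLAVar.c 0)) = false
  gen : ∀ i, k₀ ≤ i → i ≤ k → i < W → σ (ι (CLAVar.g 0 i)) = ((a i).eval σ && (b i).eval σ)
  prop : ∀ i, k₀ ≤ i → i ≤ k → i < W →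
    σ (ι (CLAVar.p 0 i)) = Bool.xor ((a i).eval σ) ((b i).eval σ)
  unit_gen : ∀ i, k₀ ≤ i → i ≤ k → i < W → ∀ l < claLayers W,
    σ (ι (CLAVar.g (l + 1) (i / 4 ^ (l + 1)))) =
      (genExpr (claG ι l (i / 4 ^ (l + 1))) (claP ι l (i / 4 ^ (l + 1))) 3).eval σ
  unit_prop : ∀ i, k₀ ≤ i → i ≤ k → i < W → ∀ l < claLayers W,
    σ (ι (CLAVar.p (l + 1) (i / 4 ^ (l + 1)))) =
      (propExpr (claP ι l (i / 4 ^ (l + 1))) 3).eval σ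
  unit_carry : ∀ i, k₀ ≤ i → i ≤ k → i < W → ∀ l < claLayers W, ∀ r < 3,
    σ (ι (CLAVar.c (i / 4 ^ (l + 1) * 4 ^ (l + 1) + (r + 1) * 4 ^ l))) =
      (claCarry ι l (i / 4 ^ (l + 1)) r).eval σ
  top : ∀ i, k₀ ≤ i → i ≤ k → i < W →
    σ (ι (CLAVar.c (4 ^ claLayers W))) = (claCarry ι (claLayers W - 1) 0 3).eval σ
  out : ∀ i, k₀ ≤ i → i ≤ k → i ≤ W →
    σ (ι (CLAVar.o i)) = (BExpr.sum3 (BExpr.var (ι (CLAVar.c i))) (a i) (b i)).eval σ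

theorem le_four_pow_claLayers (W : ℕ) : W ≤ 4 ^ claLayers W :=
  (Nat.le_pow_clog (by norm_num) W).trans
    (Nat.pow_le_pow_right (by norm_num) (le_max_right _ _))

theorem claLayers_pos (W : ℕ) : 1 ≤ claLayers W := le_max_left _ _

/-- The carry out of a block is generated in the block or propagated through it. -/
theorem CLAStrip.block_carry {W k₀ k : ℕ} {a b : ℕ → BExpr V} {ι : CLAVar → V} {σ : V → Bool}
    (h : CLAStrip W k₀ k a b ι σ) {i : ℕ} (h₀ : k₀ ≤ i) (h₁ : i ≤ k) (hW : i < W) (l : ℕ)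
    (hl : l < claLayers W) :
    σ (ι (CLAVar.c ((i / 4 ^ l + 1) * 4 ^ l))) =
      Bool.xor (σ (ι (CLAVar.g l (i / 4 ^ l))))
        (σ (ι (CLAVar.p l (i / 4 ^ l))) && σ (ι (CLAVar.c (i / 4 ^ l * 4 ^ l)))) := by
  have hiL : i < 4 ^ claLayers W := hW.trans_le (le_four_pow_claLayers W)
  have hu : ∀ l, i / 4 ^ (l + 1) = i / 4 ^ l / 4 := by
    intro l; rw [pow_succ, Nat.div_div_eq_div_mul]
  -- Induction from the top layer downwards: the carry out of the last block of a unit is the carry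
  -- out of the unit, which is itself a block of the next layer. The topmost unit has a constraint
  -- of its own.
  induction hn : claLayers W - 1 - l using Nat.strong_induction_on generalizing l with
  | _ n ih =>
    set u := i / 4 ^ (l + 1) with hu'
    have hcarry : ∀ r < 4, σ (ι (CLAVar.c (u * 4 ^ (l + 1) + (r + 1) * 4 ^ l))) =
        (claCarry ι l u r).eval σ := by
      intro r hr
      rcases Nat.lt_or_ge r 3 with hr3 | hr3
      · exact h.unit_carry i h₀ h₁ hW l hl r hr3
      obtain rfl : r = 3 := by omega
      rw [show u * 4 ^ (l + 1) + (3 + 1) * 4 ^ l = (u + 1) * 4 ^ (l + 1) by ring]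
      rcases Nat.lt_or_ge (l + 1) (claLayers W) with hl1 | hl1
      · rw [ih (claLayers W - 1 - (l + 1)) (by omega) (l + 1) hl1 rfl,
          h.unit_gen i h₀ h₁ hW l hl, h.unit_prop i h₀ h₁ hW l hl, ← hu']
        simp only [claCarry, BExpr.eval, Bool.and_comm]
      · obtain rfl : l = claLayers W - 1 := by omega
        have hL : claLayers W - 1 + 1 = claLayers W := by omega
        have hu0 : u = 0 := by
          rw [hu', hL]; exact Nat.div_eq_of_lt hiL
        rw [hu0, hL, Nat.zero_add, Nat.one_mul]
        exact h.top i h₀ h₁ hW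
    obtain ⟨q, hq, hb⟩ : ∃ q < 4, i / 4 ^ l = 4 * u + q :=
      ⟨i / 4 ^ l % 4, Nat.mod_lt _ (by norm_num), by have := hu l; omega⟩
    rw [hb, show (4 * u + q + 1) * 4 ^ l = u * 4 ^ (l + 1) + (q + 1) * 4 ^ l by ring,
      hcarry q hq]
    rcases q with _ | q
    · rw [show (4 * u + 0) * 4 ^ l = u * 4 ^ (l + 1) by ring]
      simp only [claCarry, genExpr, propExpr, BExpr.eval, claG, claP, Bool.and_comm]
    · rw [show (4 * u + (q + 1)) * 4 ^ l = u * 4 ^ (l + 1) + (q + 1) * 4 ^ l by ring,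
        hcarry q (by omega)]
      simp only [claCarry, genExpr, propExpr, BExpr.eval]
      simp only [claG, claP, BExpr.eval]
      generalize (genExpr _ _ q).eval σ = x₁
      generalize (propExpr _ q).eval σ = x₂
      generalize σ _ = x₃
      generalize σ (ι (CLAVar.p _ _)) = x₄
      generalize σ (ι (CLAVar.c _)) = x₅
      revert x₁ x₂ x₃ x₄ x₅
      decide

/-- The carry into column `i` of the adder, `0` beyond its last column. -/
def claCarryBit (W : ℕ) (ι : CLAVar → V) (σ : V → Bool) (i : ℕ) : ℤ :=
  if i ≤ W then bitVal (σ (ι (CLAVar.c i))) else 0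

/-- Generate xor (propagate and carry-in) is the majority, so the lookahead carries obey the
ripple-carry recursion. In column `W` the output is the incoming carry, and beyond it all terms are
zero. -/
theorem CLAStrip.column {W k₀ k : ℕ} {a b : ℕ → BExpr V} {ι : CLAVar → V} {σ : V → Bool}
    (h : CLAStrip W k₀ k a b ι σ) (ha : ∀ i, W ≤ i → (a i).eval σ = false)
    (hb : ∀ i, W ≤ i → (b i).eval σ = false) {i : ℕ} (h₀ : k₀ ≤ i) (h₁ : i ≤ k) :
    bitVal ((bits (W + 1) (fun i => ι (CLAVar.o i)) i).eval σ) -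
        (bitVal ((a i).eval σ) + bitVal ((b i).eval σ)) =
      claCarryBit W ι σ i - 2 * claCarryBit W ι σ (i + 1) := by
  have hadd := bitVal_adder σ (BExpr.var (ι (CLAVar.c i))) (a i) (b i)
  rcases Nat.lt_trichotomy i W with hi | rfl | hi
  · have hc := h.block_carry h₀ h₁ hi 0 (claLayers_pos W)
    simp only [pow_zero, Nat.div_one, Nat.mul_one, h.gen i h₀ h₁ hi, h.prop i h₀ h₁ hi] at hc
    have hmaj : σ (ι (CLAVar.c (i + 1))) =
        (BExpr.maj3 (BExpr.var (ι (CLAVar.c i))) (a i) (b i)).eval σ := by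
      rw [hc]
      simp only [BExpr.maj3, BExpr.eval]
      generalize σ _ = x₁
      generalize (a i).eval σ = x₂
      generalize (b i).eval σ = x₃
      revert x₁ x₂ x₃
      decide
    simp only [bits, if_pos (show i < W + 1 by omega), claCarryBit, if_pos hi.le,
      if_pos (show i + 1 ≤ W from hi), BExpr.eval, h.out i h₀ h₁ hi.le, hmaj]
    simp only [BExpr.eval] at hadd
    linarith
  · have ha' := ha i le_rfl
    have hb' := hb i le_rfl
    have hout := h.out i h₀ h₁ le_rfl
    simp only [BExpr.sum3, BExpr.eval, ha', hb', Bool.xor_false] at hout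
    simp [bits, claCarryBit, BExpr.eval, ha', hb', hout]
  · simp [bits, claCarryBit, BExpr.eval, ha i hi.le, hb i hi.le, show ¬ i < W + 1 by omega,
      show ¬ i ≤ W by omega, show ¬ i + 1 ≤ W by omega]

/-- The assignment `σ` satisfies those constraints of a Wallace tree multiplier that are needed
for the columns `k₀, …, k`. -/
structure WallaceStrip (m k₀ k : ℕ) (x y : ℕ → BExpr V) (ι : WallaceVar → V) (σ : V → Bool) :
    Prop where
  product : ∀ i, k₀ ≤ i → i ≤ k → ∀ p < colHeight m 0 i,
    σ (ι (WallaceVar.t 0 i p)) =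
      ((x (i - (p + (i + 1 - m)))).eval σ && (y (p + (i + 1 - m))).eval σ)
  sum : ∀ i, k₀ ≤ i → i ≤ k → ∀ l < lastLayer m, ∀ j, 3 * j < colHeight m l i →
    σ (ι (WallaceVar.t (l + 1) i (j + min j (carryCount m l i)))) =
      (BExpr.sum3 (tab m ι l i (3 * j)) (tab m ι l i (3 * j + 1))
        (tab m ι l i (3 * j + 2))).eval σ
  carry : ∀ i, k₀ ≤ i → i + 1 ≤ k → ∀ l < lastLayer m, ∀ j, 3 * j + 1 < colHeight m l i →
    σ (ι (WallaceVar.t (l + 1) (i + 1) (min (j + 1) (sumCount m l (i + 1)) + j))) =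
      (BExpr.maj3 (tab m ι l i (3 * j)) (tab m ι l i (3 * j + 1))
        (tab m ι l i (3 * j + 2))).eval σ
  cla : CLAStrip (finalWidth m) k₀ k (fun i => tab m ι (lastLayer m) i 0)
    (fun i => tab m ι (lastLayer m) i 1) (fun v => ι (WallaceVar.cla v)) σ

/-- The sum of the entries of column `i` of layer `l`. -/
def colSum (m : ℕ) (ι : WallaceVar → V) (σ : V → Bool) (l i : ℕ) : ℤ :=
  ∑ p ∈ Finset.range (colHeight m l i), bitVal ((tab m ι l i p).eval σ)

/-- The sum of the carry-bits that layer `l` sends to column `i` of layer `l + 1`. -/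
def carrySum (m : ℕ) (ι : WallaceVar → V) (σ : V → Bool) (l i : ℕ) : ℤ :=
  ∑ j ∈ Finset.range (carryCount m l i),
    bitVal (σ (ι (WallaceVar.t (l + 1) i (min (j + 1) (sumCount m l i) + j))))

theorem carrySum_nonneg (m : ℕ) (ι : WallaceVar → V) (σ : V → Bool) (l i : ℕ) :
    0 ≤ carrySum m ι σ l i := Finset.sum_nonneg fun _ _ => bitVal_nonneg _

theorem carrySum_le {m : ℕ} (hm : 1 ≤ m) (ι : WallaceVar → V) (σ : V → Bool) (l i : ℕ) :
    carrySum m ι σ l i ≤ m := by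
  refine (Finset.sum_le_sum fun _ _ => bitVal_le_one _).trans ?_
  simpa using carryCount_le hm l i

variable {m k₀ k : ℕ} {x y : ℕ → BExpr V} {ι : WallaceVar → V} {σ : V → Bool}

theorem tab_eval_of_lt {l i p : ℕ} (h : p < colHeight m l i) :
    (tab m ι l i p).eval σ = σ (ι (WallaceVar.t l i p)) := by
  rw [tab, if_pos h]; rfl

theorem tab_eval_of_le {l i p : ℕ} (h : colHeight m l i ≤ p) :
    (tab m ι l i p).eval σ = false := by
  rw [tab, if_neg (by omega)]; rfl

/-- A column of layer `l` in terms of the outputs of its adders. -/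
theorem WallaceStrip.colSum_adders (h : WallaceStrip m k₀ k x y ι σ) {l i : ℕ}
    (hl : l < lastLayer m) (h₀ : k₀ ≤ i) (h₁ : i ≤ k) :
    ∃ c : ℤ, (i + 1 ≤ k → c = carrySum m ι σ l (i + 1)) ∧
      colSum m ι σ (l + 1) i - colSum m ι σ l i = carrySum m ι σ l i - 2 * c := by
  set M : ℕ → Bool := fun j => (BExpr.maj3 (tab m ι l i (3 * j)) (tab m ι l i (3 * j + 1))
    (tab m ι l i (3 * j + 2))).eval σ with hM
  -- The majority values are used instead of the carry variables: carries out of column `k` leave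
  -- the strip, where nothing is assumed about their variables.
  refine ⟨∑ j ∈ Finset.range ((colHeight m l i + 1) / 3), bitVal (M j), ?_, ?_⟩
  · intro h2
    refine Finset.sum_congr rfl fun j hj => ?_
    rw [Finset.mem_range] at hj
    simp only [carryCount] at hj
    rw [h.carry i h₀ h2 l hl j (by omega)]
  · have h1 : colSum m ι σ l i = ∑ j ∈ Finset.range (sumCount m l i),
        (bitVal (σ (ι (WallaceVar.t (l + 1) i (j + min j (carryCount m l i))))) +
          2 * bitVal (M j)) := by
      rw [colSum, sum_range_groups _ _ fun p hp => by rw [tab_eval_of_le hp]; rfl]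
      refine Finset.sum_congr rfl fun j hj => ?_
      rw [Finset.mem_range] at hj
      simp only [sumCount] at hj
      rw [h.sum i h₀ h₁ l hl j (by omega), bitVal_adder]
    -- The possible extra adder has a single input, and its majority is zero.
    have h2 : ∑ j ∈ Finset.range ((colHeight m l i + 1) / 3), bitVal (M j) =
        ∑ j ∈ Finset.range (sumCount m l i), bitVal (M j) := by
      refine Finset.sum_subset (Finset.range_subset_range.2 (by simp only [sumCount]; omega))
        fun j _ hj => ?_
      rw [Finset.mem_range] at hj
      simp only [hM, BExpr.maj3, BExpr.eval, tab_eval_of_le (show colHeight m l i ≤ 3 * j + 1 by omega),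
        tab_eval_of_le (show colHeight m l i ≤ 3 * j + 2 by omega)]
      simp
    have h3 : colSum m ι σ (l + 1) i = ∑ j ∈ Finset.range (sumCount m l i),
        bitVal (σ (ι (WallaceVar.t (l + 1) i (j + min j (carryCount m l i))))) +
          carrySum m ι σ l i := by
      have h4 : colSum m ι σ (l + 1) i = ∑ q ∈ Finset.range (sumCount m l i + carryCount m l i),
          bitVal (σ (ι (WallaceVar.t (l + 1) i q))) := by
        rw [colSum, colHeight_succ]
        refine Finset.sum_congr rfl fun q hq => ?_
        rw [Finset.mem_range] at hq
        rw [tab_eval_of_lt (by rwa [colHeight_succ])]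
      rw [h4, sum_range_interleave (fun q => bitVal (σ (ι (WallaceVar.t (l + 1) i q))))]
      rfl
    rw [h1, h2, h3, Finset.sum_add_distrib, ← Finset.mul_sum]
    ring

/-- The carries inside the strip telescope. Only those entering column `k₀` and a multiple `q` of
the weight of column `k + 1` survive. -/
theorem WallaceStrip.layer (h : WallaceStrip m k₀ k x y ι σ) (hk : k₀ ≤ k) {l : ℕ}
    (hl : l < lastLayer m) :
    ∃ q : ℤ, ∑ d ∈ Finset.range (k - k₀ + 1), 2 ^ d * colSum m ι σ (l + 1) (k₀ + d) =
      ∑ d ∈ Finset.range (k - k₀ + 1), 2 ^ d * colSum m ι σ l (k₀ + d) +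
        carrySum m ι σ l k₀ - 2 ^ (k - k₀ + 1) * q := by
  obtain ⟨q, -, hq⟩ := h.colSum_adders hl hk le_rfl
  have := sum_two_pow_carry
    (fun d => colSum m ι σ (l + 1) (k₀ + d) - colSum m ι σ l (k₀ + d))
    (fun d => if k₀ + d ≤ k then carrySum m ι σ l (k₀ + d) else q) (k - k₀ + 1) (by
      intro d hd
      rcases Nat.lt_or_ge (k₀ + d) k with h1 | h1
      · obtain ⟨c, hc, hc'⟩ := h.colSum_adders hl (Nat.le_add_right k₀ d) h1.le
        simp only [if_pos h1.le, if_pos (show k₀ + (d + 1) ≤ k by omega), hc']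
        rw [hc h1]; rfl
      · obtain rfl : k = k₀ + d := by omega
        simp only [le_refl, if_true, if_neg (show ¬ k₀ + (d + 1) ≤ k₀ + d by omega)]
        exact hq)
  refine ⟨q, ?_⟩
  simp only [mul_sub, Finset.sum_sub_distrib, Nat.add_zero, if_pos hk,
    if_neg (show ¬ k₀ + (k - k₀ + 1) ≤ k by omega)] at this
  linarith

theorem WallaceStrip.layers (h : WallaceStrip m k₀ k x y ι σ) (hk : k₀ ≤ k) {l : ℕ}
    (hl : l ≤ lastLayer m) :
    ∃ q : ℤ, ∑ d ∈ Finset.range (k - k₀ + 1), 2 ^ d * colSum m ι σ l (k₀ + d) =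
      ∑ d ∈ Finset.range (k - k₀ + 1), 2 ^ d * colSum m ι σ 0 (k₀ + d) +
        ∑ l' ∈ Finset.range l, carrySum m ι σ l' k₀ - 2 ^ (k - k₀ + 1) * q := by
  induction l with
  | zero => exact ⟨0, by simp⟩
  | succ l ih =>
    obtain ⟨q, hq⟩ := ih (by omega)
    obtain ⟨q', hq'⟩ := h.layer hk (show l < lastLayer m by omega)
    refine ⟨q + q', ?_⟩
    rw [hq', hq, Finset.sum_range_succ (fun l' => carrySum m ι σ l' k₀)]
    ring

theorem WallaceStrip.colSum_zero (h : WallaceStrip m k₀ k x y ι σ)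
    (hx : ∀ r, m ≤ r → (x r).eval σ = false) (hy : ∀ r, m ≤ r → (y r).eval σ = false) {i : ℕ}
    (h₀ : k₀ ≤ i) (h₁ : i ≤ k) :
    colSum m ι σ 0 i = ∑ j ∈ Finset.range (i + 1),
      bitVal ((x (i - j)).eval σ) * bitVal ((y j).eval σ) := by
  have h1 : colSum m ι σ 0 i = ∑ p ∈ Finset.range (min (i + 1) m - (i + 1 - m)),
      bitVal ((x (i - ((i + 1 - m) + p))).eval σ) *
        bitVal ((y ((i + 1 - m) + p)).eval σ) := by
    refine Finset.sum_congr rfl fun p hp => ?_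
    rw [Finset.mem_range] at hp
    rw [tab_eval_of_lt hp, h.product i h₀ h₁ p hp, bitVal_and, Nat.add_comm p]
  rw [h1, ← Finset.sum_Ico_eq_sum_range
    (fun j => bitVal ((x (i - j)).eval σ) * bitVal ((y j).eval σ))]
  refine Finset.sum_subset (fun j hj => ?_) fun j hj hj' => ?_
  · rw [Finset.mem_Ico] at hj
    rw [Finset.mem_range]
    omega
  · rw [Finset.mem_range] at hj
    rw [Finset.mem_Ico] at hj'
    rcases Nat.lt_or_ge j m with hjm | hjm
    · rw [hx (i - j) (by omega)]; simp
    · rw [hy j hjm]; simp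

theorem colSum_lastLayer (i : ℕ) :
    colSum m ι σ (lastLayer m) i = bitVal ((tab m ι (lastLayer m) i 0).eval σ) +
      bitVal ((tab m ι (lastLayer m) i 1).eval σ) := by
  have h2 := lastLayer_spec m i
  have : colSum m ι σ (lastLayer m) i =
      ∑ p ∈ Finset.range 2, bitVal ((tab m ι (lastLayer m) i p).eval σ) := by
    refine Finset.sum_subset (Finset.range_subset_range.2 h2) fun p _ hp => ?_
    rw [tab_eval_of_le (by simpa using hp)]; rfl
  rw [this, Finset.sum_range_succ, Finset.sum_range_one]

/-- In a strip the multiplier computes the product up to the carries from the right. -/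
theorem WallaceStrip.output (h : WallaceStrip m k₀ k x y ι σ) (hm : 1 ≤ m) (hk : k₀ ≤ k)
    (hx : ∀ r, m ≤ r → (x r).eval σ = false) (hy : ∀ r, m ≤ r → (y r).eval σ = false) :
    ∃ E q : ℤ, 0 ≤ E ∧ E ≤ m * m + 1 ∧ (k₀ = 0 → E = 0) ∧
      ∑ d ∈ Finset.range (k - k₀ + 1), 2 ^ d *
          bitVal ((bits (wallaceOutputs m) (fun i => ι (WallaceVar.cla (CLAVar.o i)))
            (k₀ + d)).eval σ) =
        ∑ d ∈ Finset.range (k - k₀ + 1), 2 ^ d * ∑ j ∈ Finset.range (k₀ + d + 1),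
          bitVal ((x (k₀ + d - j)).eval σ) * bitVal ((y j).eval σ) + E -
            2 ^ (k - k₀ + 1) * q := by
  obtain ⟨q, hq⟩ := h.layers hk le_rfl
  set c := claCarryBit (finalWidth m) (fun v => ι (WallaceVar.cla v)) σ with hc
  have hcla := sum_two_pow_carry (fun d =>
    bitVal ((bits (wallaceOutputs m) (fun i => ι (WallaceVar.cla (CLAVar.o i))) (k₀ + d)).eval σ) -
      colSum m ι σ (lastLayer m) (k₀ + d)) (fun d => c (k₀ + d)) (k - k₀ + 1) (by
      intro d hd
      have := h.cla.column
        (fun i hi => tab_eval_of_le (by rw [colHeight_finalWidth hi]))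
        (fun i hi => tab_eval_of_le (by rw [colHeight_finalWidth hi]; omega))
        (Nat.le_add_right k₀ d) (show k₀ + d ≤ k by omega)
      rw [colSum_lastLayer]
      exact this)
  have hc0 : 0 ≤ c k₀ ∧ c k₀ ≤ 1 := by
    simp only [hc, claCarryBit]
    split_ifs
    · exact ⟨bitVal_nonneg _, bitVal_le_one _⟩
    · simp
  -- Everything that enters column `k₀` from the right: at most `m` carry-bits from each of at most
  -- `m` layers, and one carry of the final adder.
  refine ⟨∑ l ∈ Finset.range (lastLayer m), carrySum m ι σ l k₀ + c k₀,
    q + c (k₀ + (k - k₀ + 1)), ?_, ?_, ?_, ?_⟩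
  · exact add_nonneg (Finset.sum_nonneg fun _ _ => carrySum_nonneg _ _ _ _ _) hc0.1
  · have h1 : ∑ l ∈ Finset.range (lastLayer m), carrySum m ι σ l k₀ ≤ lastLayer m * (m : ℤ) := by
      refine (Finset.sum_le_sum fun _ _ => carrySum_le hm _ _ _ _).trans ?_
      simp
    have h2 : (lastLayer m : ℤ) ≤ m := by exact_mod_cast lastLayer_le m
    nlinarith [hc0.2]
  · rintro rfl
    have h1 : c 0 = 0 := by
      simp only [hc, claCarryBit, h.cla.init rfl]
      simp
    rw [h1]
    simp [carrySum, carryCount]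
  · simp only [mul_sub, Finset.sum_sub_distrib, Nat.add_zero] at hcla
    have h3 : ∑ d ∈ Finset.range (k - k₀ + 1), (2 : ℤ) ^ d * colSum m ι σ 0 (k₀ + d) =
        ∑ d ∈ Finset.range (k - k₀ + 1), 2 ^ d * ∑ j ∈ Finset.range (k₀ + d + 1),
          bitVal ((x (k₀ + d - j)).eval σ) * bitVal ((y j).eval σ) := by
      refine Finset.sum_congr rfl fun d hd => ?_
      rw [Finset.mem_range] at hd
      rw [h.colSum_zero hx hy (Nat.le_add_right k₀ d) (by omega)]
    rw [← h3]
    linarith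

end Multiplier

/-! ### Ripple-carry adder in a strip -/

section Ripple

variable {V : Type}

/-- The assignment `σ` satisfies the constraints of the columns `k₀, …, k` of a ripple-carry
adder. -/
structure RippleStrip (N k₀ k : ℕ) (a b : ℕ → BExpr V) (ι : RippleVar → V) (σ : V → Bool) :
    Prop where
  out : ∀ i, k₀ ≤ i → i ≤ k → i < N →
    σ (ι (RippleVar.o i)) = (BExpr.sum3 (rippleCarryIn ι i) (a i) (b i)).eval σ
  carry : ∀ i, k₀ ≤ i → i ≤ k → i < N →
    σ (ι (RippleVar.c i)) = (BExpr.maj3 (rippleCarryIn ι i) (a i) (b i)).eval σ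
  top : k₀ ≤ N → N ≤ k → σ (ι (RippleVar.o N)) = (rippleCarryIn ι N).eval σ

/-- The carry into column `i` of the adder, `0` beyond its last column. -/
def rippleCarryBit (N : ℕ) (ι : RippleVar → V) (σ : V → Bool) (i : ℕ) : ℤ :=
  if i ≤ N then bitVal ((rippleCarryIn ι i).eval σ) else 0

theorem rippleCarryBit_zero (N : ℕ) (ι : RippleVar → V) (σ : V → Bool) :
    rippleCarryBit N ι σ 0 = 0 := by
  simp [rippleCarryBit, rippleCarryIn, BExpr.eval]

theorem rippleCarryBit_nonneg (N : ℕ) (ι : RippleVar → V) (σ : V → Bool) (i : ℕ) :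
    0 ≤ rippleCarryBit N ι σ i := by
  rw [rippleCarryBit]; split_ifs
  · exact bitVal_nonneg _
  · exact le_rfl

theorem rippleCarryBit_le_one (N : ℕ) (ι : RippleVar → V) (σ : V → Bool) (i : ℕ) :
    rippleCarryBit N ι σ i ≤ 1 := by
  rw [rippleCarryBit]; split_ifs
  · exact bitVal_le_one _
  · exact zero_le_one

theorem RippleStrip.column {N k₀ k : ℕ} {a b : ℕ → BExpr V} {ι : RippleVar → V} {σ : V → Bool}
    (h : RippleStrip N k₀ k a b ι σ) (ha : ∀ i, N ≤ i → (a i).eval σ = false)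
    (hb : ∀ i, N ≤ i → (b i).eval σ = false) {i : ℕ} (h₀ : k₀ ≤ i) (h₁ : i ≤ k) :
    bitVal ((bits (N + 1) (fun i => ι (RippleVar.o i)) i).eval σ) -
        (bitVal ((a i).eval σ) + bitVal ((b i).eval σ)) =
      rippleCarryBit N ι σ i - 2 * rippleCarryBit N ι σ (i + 1) := by
  have hadd := bitVal_adder σ (rippleCarryIn ι i) (a i) (b i)
  rcases Nat.lt_trichotomy i N with hi | rfl | hi
  · simp only [bits, if_pos (show i < N + 1 by omega), rippleCarryBit, if_pos hi.le,
      if_pos (show i + 1 ≤ N from hi), BExpr.eval, h.out i h₀ h₁ hi]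
    rw [show (rippleCarryIn ι (i + 1)).eval σ = σ (ι (RippleVar.c i)) from rfl,
      h.carry i h₀ h₁ hi]
    linarith
  · simp [bits, rippleCarryBit, BExpr.eval, ha i le_rfl, hb i le_rfl, h.top h₀ h₁]
  · simp [bits, rippleCarryBit, BExpr.eval, ha i hi.le, hb i hi.le, show ¬ i < N + 1 by omega,
      show ¬ i ≤ N by omega, show ¬ i + 1 ≤ N by omega]

end Ripple

theorem bits_eval_of_le {V : Type} {N i : ℕ} {v : ℕ → V} {σ : V → Bool} (h : N ≤ i) :
    (bits N v i).eval σ = false := by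
  rw [bits, if_neg (by omega)]; rfl

/-! ### The distributive law in a strip -/

namespace DistVar

/-- The assignment `σ` satisfies the constraints of the distributivity instance that are needed
for the columns `k₀, …, k`. -/
structure DistStrip (n k₀ k : ℕ) (σ : DistVar → Bool) : Prop where
  -- This adder is needed from column `0` on, since the products in column `i` involve the bits of
  -- `y + z` in all positions `j ≤ i`.
  addYZ : RippleStrip n 0 k (bits n y) (bits n z) DistVar.addYZ σ
  mulXYZ : WallaceStrip (n + 1) k₀ k (bits n x)
    (bits (n + 1) fun i => DistVar.addYZ (RippleVar.o i)) DistVar.mulXYZ σ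
  mulXY : WallaceStrip n k₀ k (bits n x) (bits n y) DistVar.mulXY σ
  mulXZ : WallaceStrip n k₀ k (bits n x) (bits n z) DistVar.mulXZ σ
  addXYXZ : RippleStrip (wallaceOutputs n) k₀ k
    (bits (wallaceOutputs n) fun i => DistVar.mulXY (WallaceVar.cla (CLAVar.o i)))
    (bits (wallaceOutputs n) fun i => DistVar.mulXZ (WallaceVar.cla (CLAVar.o i)))
    DistVar.addXYXZ σ
  diff : ∀ i, k₀ ≤ i → i ≤ k →
    σ (e i) = Bool.xor ((outL n i).eval σ) ((outR n i).eval σ)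

/-- The distributive law in a strip, up to the carries from the right. -/
theorem DistStrip.products {n k₀ k : ℕ} {σ : DistVar → Bool} (h : DistStrip n k₀ k σ)
    (hk : k₀ ≤ k) : ∃ E q : ℤ, 0 ≤ E ∧ E ≤ n + 1 ∧ (k₀ = 0 → E = 0) ∧
      ∑ d ∈ Finset.range (k - k₀ + 1), 2 ^ d * ∑ j ∈ Finset.range (k₀ + d + 1),
          bitVal ((bits n x (k₀ + d - j)).eval σ) *
            bitVal ((bits (n + 1) (fun i => DistVar.addYZ (RippleVar.o i)) j).eval σ) =
        ∑ d ∈ Finset.range (k - k₀ + 1), 2 ^ d * ∑ j ∈ Finset.range (k₀ + d + 1),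
          bitVal ((bits n x (k₀ + d - j)).eval σ) * bitVal ((bits n y j).eval σ) +
        ∑ d ∈ Finset.range (k - k₀ + 1), 2 ^ d * ∑ j ∈ Finset.range (k₀ + d + 1),
          bitVal ((bits n x (k₀ + d - j)).eval σ) * bitVal ((bits n z j).eval σ) +
        E - 2 ^ (k - k₀ + 1) * q := by
  set X : ℕ → ℤ := fun r => bitVal ((bits n x r).eval σ)
  set S : ℕ → ℤ := fun j =>
    bitVal ((bits (n + 1) (fun i => DistVar.addYZ (RippleVar.o i)) j).eval σ)
  set Y : ℕ → ℤ := fun j => bitVal ((bits n y j).eval σ)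
  set Z : ℕ → ℤ := fun j => bitVal ((bits n z j).eval σ)
  set C := rippleCarryBit n DistVar.addYZ σ with hC
  have hcol : ∀ j ≤ k, S j - (Y j + Z j) = C j - 2 * C (j + 1) := fun j hj =>
    h.addYZ.column (fun i hi => bits_eval_of_le hi) (fun i hi => bits_eval_of_le hi)
      (Nat.zero_le j) hj
  -- The convolution of `x` with the carries of `y + z`. No carry enters column `0`, so shifting the
  -- index gives `T (i + 1)`, and `T` obeys a carry identity of its own.
  set T : ℕ → ℤ := fun i => ∑ j ∈ Finset.range (i + 1), X (i - j) * C j with hT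
  have hTsucc : ∀ i, T (i + 1) = ∑ j ∈ Finset.range (i + 1), X (i - j) * C (j + 1) := by
    intro i
    simp only [hT]
    rw [Finset.sum_range_succ', hC, rippleCarryBit_zero]
    simp
  have hchain := sum_two_pow_carry (fun d => ∑ j ∈ Finset.range (k₀ + d + 1),
      X (k₀ + d - j) * S j - (∑ j ∈ Finset.range (k₀ + d + 1), X (k₀ + d - j) * Y j +
        ∑ j ∈ Finset.range (k₀ + d + 1), X (k₀ + d - j) * Z j))
    (fun d => T (k₀ + d)) (k - k₀ + 1) (by
      intro d hd
      rcases Nat.lt_or_ge k (k₀ + d) with hlt | hle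
      · omega
      · rw [← add_assoc, hTsucc]
        simp only [hT]
        rw [← Finset.sum_add_distrib, ← Finset.sum_sub_distrib, Finset.mul_sum,
          ← Finset.sum_sub_distrib]
        refine Finset.sum_congr rfl fun j hj => ?_
        rw [Finset.mem_range] at hj
        linear_combination X (k₀ + d - j) * hcol j (by omega))
  have hterm : ∀ i j, 0 ≤ X (i - j) * C j ∧ X (i - j) * C j ≤ 1 := by
    intro i j
    have h1 : 0 ≤ X (i - j) := bitVal_nonneg _
    have h2 : X (i - j) ≤ 1 := bitVal_le_one _
    have h3 : 0 ≤ C j := rippleCarryBit_nonneg _ _ _ _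
    have h4 : C j ≤ 1 := rippleCarryBit_le_one _ _ _ _
    exact ⟨mul_nonneg h1 h3, mul_le_one₀ h2 h3 h4⟩
  refine ⟨T k₀, T (k₀ + (k - k₀ + 1)), Finset.sum_nonneg fun j _ => (hterm _ j).1, ?_, ?_, ?_⟩
  -- Carries beyond column `n` are zero, so at most `n + 1` terms count even if `k₀` is larger.
  · have h1 : T k₀ ≤ ∑ j ∈ Finset.range (n + 1), X (k₀ - j) * C j := by
      simp only [hT]
      rw [← Finset.sum_filter_add_sum_filter_not (Finset.range (k₀ + 1)) (fun j => j < n + 1)]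
      have h2 : ∑ j ∈ (Finset.range (k₀ + 1)).filter (fun j => ¬ j < n + 1),
          X (k₀ - j) * C j = 0 := by
        refine Finset.sum_eq_zero fun j hj => ?_
        have hj' := (Finset.mem_filter.1 hj).2
        rw [hC, rippleCarryBit, if_neg (by omega), mul_zero]
      rw [h2, add_zero]
      refine Finset.sum_le_sum_of_subset_of_nonneg (fun j hj => ?_) fun j _ _ => (hterm _ j).1
      exact Finset.mem_range.2 (Finset.mem_filter.1 hj).2
    refine h1.trans ((Finset.sum_le_sum fun j _ => (hterm k₀ j).2).trans ?_)
    simp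
  · rintro rfl
    simp [hT, hC, rippleCarryBit_zero]
  · simp only [mul_sub, mul_add, Finset.sum_sub_distrib, Finset.sum_add_distrib,
      Nat.add_zero] at hchain
    linarith

/-- The circuits cannot disagree in column `k` and agree in the columns `k₀, …, k - 1`. -/
theorem DistStrip.false {n k₀ k : ℕ} {σ : DistVar → Bool} (h : DistStrip n k₀ k σ)
    (hn : 1 ≤ n) (hk : k₀ ≤ k) (hlarge : k₀ = 0 ∨ 4 * (n + 1) ^ 2 < 2 ^ (k - k₀))
    (he : ∀ i < k, σ (e i) = false) (hek : σ (e k) = true) : False := by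
  obtain ⟨E, q, hE0, hE1, hE2, hE⟩ := h.products hk
  obtain ⟨E₁, q₁, h10, h11, h12, h1⟩ := h.mulXYZ.output (by omega) hk
    (fun r hr => bits_eval_of_le (by omega)) (fun r hr => bits_eval_of_le hr)
  obtain ⟨E₂, q₂, h20, h21, h22, h2⟩ := h.mulXY.output hn hk
    (fun r hr => bits_eval_of_le hr) (fun r hr => bits_eval_of_le hr)
  obtain ⟨E₃, q₃, h30, h31, h32, h3⟩ := h.mulXZ.output hn hk
    (fun r hr => bits_eval_of_le hr) (fun r hr => bits_eval_of_le hr)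
  have h4 := sum_two_pow_carry (fun d =>
      bitVal ((outR n (k₀ + d)).eval σ) -
      (bitVal ((bits (wallaceOutputs n)
          (fun i => DistVar.mulXY (WallaceVar.cla (CLAVar.o i))) (k₀ + d)).eval σ) +
        bitVal ((bits (wallaceOutputs n)
          (fun i => DistVar.mulXZ (WallaceVar.cla (CLAVar.o i))) (k₀ + d)).eval σ)))
    (fun d => rippleCarryBit (wallaceOutputs n) DistVar.addXYXZ σ (k₀ + d)) (k - k₀ + 1)
    (fun d hd => h.addXYXZ.column (fun i hi => bits_eval_of_le hi)
      (fun i hi => bits_eval_of_le hi) (Nat.le_add_right k₀ d) (by omega))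
  -- Agreement below column `k` and disagreement in it leave a weighted difference of exactly `± 2 ^
  -- (k - k₀)`.
  have h5 : ∃ ε : ℤ, (ε = 1 ∨ ε = -1) ∧
      ∑ d ∈ Finset.range (k - k₀ + 1), 2 ^ d * bitVal ((outL n (k₀ + d)).eval σ) =
        ∑ d ∈ Finset.range (k - k₀ + 1), 2 ^ d * bitVal ((outR n (k₀ + d)).eval σ) +
          2 ^ (k - k₀) * ε := by
    rw [Finset.sum_range_succ, Finset.sum_range_succ, Nat.add_sub_cancel' hk]
    have h6 : ∑ d ∈ Finset.range (k - k₀), (2 : ℤ) ^ d * bitVal ((outL n (k₀ + d)).eval σ) =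
        ∑ d ∈ Finset.range (k - k₀), 2 ^ d * bitVal ((outR n (k₀ + d)).eval σ) := by
      refine Finset.sum_congr rfl fun d hd => ?_
      rw [Finset.mem_range] at hd
      have h7 := h.diff (k₀ + d) (Nat.le_add_right _ _) (by omega)
      rw [he _ (by omega)] at h7
      congr 2
      revert h7
      generalize (outL n (k₀ + d)).eval σ = u
      generalize (outR n (k₀ + d)).eval σ = v
      revert u v; decide
    have h7 := h.diff k hk le_rfl
    rw [hek] at h7
    refine ⟨bitVal ((outL n k).eval σ) - bitVal ((outR n k).eval σ), ?_, ?_⟩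
    · revert h7
      generalize (outL n k).eval σ = u
      generalize (outR n k).eval σ = v
      revert u v; decide
    · rw [h6]; ring
  obtain ⟨ε, hε, h5⟩ := h5
  simp only [mul_sub, mul_add, Finset.sum_sub_distrib, Finset.sum_add_distrib,
    Nat.add_zero] at h4
  set c := rippleCarryBit (wallaceOutputs n) DistVar.addXYXZ σ with hc
  have hc0 : 0 ≤ c k₀ := rippleCarryBit_nonneg _ _ _ _
  have hc1 : c k₀ ≤ 1 := rippleCarryBit_le_one _ _ _ _
  have hLeq : ∑ d ∈ Finset.range (k - k₀ + 1), (2 : ℤ) ^ d * bitVal ((bits (wallaceOutputs (n + 1))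
      (fun i => DistVar.mulXYZ (WallaceVar.cla (CLAVar.o i))) (k₀ + d)).eval σ) =
      ∑ d ∈ Finset.range (k - k₀ + 1), 2 ^ d * bitVal ((outL n (k₀ + d)).eval σ) := rfl
  -- All outgoing carries are absorbed into `Q`. The factor `ε + 2 * Q` is odd, so the left side is
  -- at least `2 ^ (k - k₀)` in absolute value, while the net incoming carry on the right is
  -- smaller.
  obtain ⟨Q, hQ⟩ : ∃ Q : ℤ, 2 ^ (k - k₀) * (ε + 2 * Q) = E + E₁ - E₂ - E₃ - c k₀ :=
    ⟨q + q₁ - q₂ - q₃ - c (k₀ + (k - k₀ + 1)), by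
      linear_combination -h5 + h1 - hLeq + hE - h2 - h3 - h4⟩
  have hlt : |E + E₁ - E₂ - E₃ - c k₀| < 2 ^ (k - k₀) := by
    rcases hlarge with h0 | h0
    · subst h0
      rw [hE2 rfl, h12 rfl, h22 rfl, h32 rfl, hc, rippleCarryBit_zero]
      simp
    · have h0' : 4 * ((n : ℤ) + 1) ^ 2 < 2 ^ (k - k₀) := by exact_mod_cast h0
      push_cast at h11
      rw [abs_lt]
      constructor <;> nlinarith
  rw [← hQ, abs_mul, abs_of_pos (by positivity : (0 : ℤ) < 2 ^ (k - k₀))] at hlt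
  have h8 : 1 ≤ |ε + 2 * Q| := by
    refine Int.one_le_abs ?_
    omega
  have h9 : (0 : ℤ) < 2 ^ (k - k₀) := by positivity
  nlinarith

end DistVar

/-! ### Path decomposition of a strip -/

/-! ### Shape of the Wallace tree -/

theorem colHeight_zero_le (m l : ℕ) : colHeight m l 0 ≤ 1 := by
  induction l with
  | zero => simp only [colHeight]; omega
  | succ l ih => simp only [colHeight]; omega

/-- A new height is about a third of the sum of two neighbouring old heights, so differences between
neighbours do not accumulate; `4` is stable under the rounding. -/
theorem colHeight_adjacent (m l i : ℕ) :
    colHeight m l (i + 1) ≤ colHeight m l i + 4 ∧ colHeight m l i ≤ colHeight m l (i + 1) + 4 := by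
  induction l generalizing i with
  | zero => simp only [colHeight]; omega
  | succ l ih =>
    cases i with
    | zero =>
      have h1 := ih 0
      have h2 := colHeight_zero_le m l
      simp only [colHeight]; omega
    | succ i =>
      have h1 := ih i
      have h2 := ih (i + 1)
      simp only [colHeight]; omega

/-- Hence sum-bits and carry-bits alternate almost to the end of a column, and the outputs of adder
`j` lie within distance `4` of position `2 j`. -/
theorem sumCount_carryCount (m l i : ℕ) :
    sumCount m l i ≤ carryCount m l i + 3 ∧ carryCount m l i ≤ sumCount m l i + 3 := by
  cases i with
  | zero =>
    have := colHeight_zero_le m l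
    simp only [sumCount, carryCount]; omega
  | succ i =>
    have := colHeight_adjacent m l i
    simp only [sumCount, carryCount]; omega

/-- Three rows become two, so the excess of the height over `2` shrinks by a factor `2 / 3` per
layer. -/
theorem exists_colHeight_le (m l : ℕ) :
    ∃ M, M * 3 ^ l ≤ 2 ^ l * m ∧ ∀ i, colHeight m l i ≤ 2 + M := by
  induction l with
  | zero => exact ⟨m, by simp, fun i => by have := colHeight_le m 0 i; omega⟩
  | succ l ih =>
    obtain ⟨M, hM, h⟩ := ih
    refine ⟨2 * M / 3, ?_, fun i => ?_⟩
    · have h1 := Nat.div_mul_le_self (2 * M) 3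
      calc 2 * M / 3 * 3 ^ (l + 1) = 2 * M / 3 * 3 * 3 ^ l := by ring
        _ ≤ 2 * M * 3 ^ l := Nat.mul_le_mul_right _ h1
        _ = 2 * (M * 3 ^ l) := by ring
        _ ≤ 2 * (2 ^ l * m) := Nat.mul_le_mul_left _ hM
        _ = 2 ^ (l + 1) * m := by ring
    · have := colHeight_le_of_le h i
      omega

/-- After `2 c` layers the excess is at most `(4 / 9) ^ c * 2 ^ c = (8 / 9) ^ c < 1`, hence zero. -/
theorem lastLayer_le_two_mul {m c : ℕ} (hc : 1 ≤ c) (hm : m ≤ 2 ^ c) : lastLayer m ≤ 2 * c := by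
  refine lastLayer_le_of fun i => ?_
  obtain ⟨M, hM, h⟩ := exists_colHeight_le m (2 * c)
  have h1 : M * 9 ^ c ≤ 8 ^ c := by
    calc M * 9 ^ c = M * 3 ^ (2 * c) := by rw [pow_mul]; norm_num
      _ ≤ 2 ^ (2 * c) * m := hM
      _ ≤ 2 ^ (2 * c) * 2 ^ c := Nat.mul_le_mul_left _ hm
      _ = 8 ^ c := by rw [pow_mul, ← mul_pow]; norm_num
  have h2 : 8 ^ c < 9 ^ c := Nat.pow_lt_pow_left (by norm_num) (by omega)
  have h3 : M = 0 := by
    by_contra h0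
    have : 1 * 9 ^ c ≤ M * 9 ^ c := Nat.mul_le_mul_right _ (by omega)
    omega
  have := h i
  omega

theorem claLayers_le {m c : ℕ} (hm : m ≤ 2 ^ c) : claLayers (finalWidth m) ≤ c + 2 := by
  refine max_le (by omega) (Nat.clog_le_of_le_pow ?_)
  have h1 := finalWidth_le m
  have h2 : 2 ^ c ≤ 4 ^ c := Nat.pow_le_pow_left (by norm_num) c
  rw [pow_add]
  omega

/-- The unit of time for the entries of layer `l`: the entries `3 j` of layer `l` and `2 j` of
layer `l + 1` are visited at the same time. -/
def layerUnit (Λ l : ℕ) : ℤ := 3 ^ l * 2 ^ (Λ - l)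

theorem layerUnit_pos (Λ l : ℕ) : 0 < layerUnit Λ l := by unfold layerUnit; positivity

theorem layerUnit_succ {Λ l : ℕ} (h : l < Λ) : layerUnit Λ (l + 1) * 2 = layerUnit Λ l * 3 := by
  unfold layerUnit
  rw [show Λ - l = (Λ - (l + 1)) + 1 by omega]
  ring

/-! ### Constraints whose variables share a time -/

section Local

variable {V : Type} [DecidableEq V]

/-- The assignment `σ` satisfies all constraints of `F` whose variables live at a common time. -/
def SatisfiesLocally (F : CNF V) (live : ℤ → V → Prop) (σ : V → Bool) : Prop :=
  ∀ τ v ex, constrain v ex ⊆ F → live τ v → (∀ u ∈ ex.vars, live τ u) → σ v = ex.eval σ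

/-- The clause forbidding the current values of a violated constraint has no variables other than
those of the constraint, so it is falsified and live at the same time. -/
theorem satisfiesLocally_of_not_falsified {F : CNF V} {live : ℤ → V → Prop} {σ : V → Bool}
    (h : ¬ ∃ C ∈ F, Falsifies σ C ∧ ∃ τ, ∀ l ∈ C, live τ l.1) : SatisfiesLocally F live σ := by
  intro τ v ex hF hv hvars
  by_contra hne
  refine h ⟨forbid (insert v ex.vars) σ, hF ⟨σ, hne, rfl⟩, ?_, τ, ?_⟩
  · intro l hl
    obtain ⟨u, -, rfl⟩ := Finset.mem_image.1 hl
    cases σ u <;> simp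
  · intro l hl
    obtain ⟨u, hu, rfl⟩ := Finset.mem_image.1 hl
    rcases Finset.mem_insert.1 hu with rfl | hu
    · exact hv
    · exact hvars u hu

theorem SatisfiesLocally.mono {F F' : CNF V} {live : ℤ → V → Prop} {σ : V → Bool}
    (h : SatisfiesLocally F live σ) (hF : F' ⊆ F) : SatisfiesLocally F' live σ :=
  fun τ v ex h' => h τ v ex (h'.trans hF)

theorem mem_vars_sum3 {a b c : BExpr V} {u : V} :
    u ∈ (BExpr.sum3 a b c).vars ↔ u ∈ a.vars ∨ u ∈ b.vars ∨ u ∈ c.vars := by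
  simp [BExpr.sum3, BExpr.vars]

theorem mem_vars_maj3 {a b c : BExpr V} {u : V} :
    u ∈ (BExpr.maj3 a b c).vars ↔ u ∈ a.vars ∨ u ∈ b.vars ∨ u ∈ c.vars := by
  simp only [BExpr.maj3, BExpr.vars, Finset.mem_union]
  tauto

theorem mem_vars_bits {N i : ℕ} {v : ℕ → V} {u : V} :
    u ∈ (bits N v i).vars ↔ i < N ∧ u = v i := by
  rw [bits]; split_ifs with h <;> simp [BExpr.vars, h]

theorem mem_vars_tab {m l i p : ℕ} {ι : WallaceVar → V} {u : V} :
    u ∈ (tab m ι l i p).vars ↔ p < colHeight m l i ∧ u = ι (WallaceVar.t l i p) := by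
  rw [tab]; split_ifs with h <;> simp [BExpr.vars, h]

theorem mem_vars_genExpr {ι : CLAVar → V} {l u r : ℕ} {v : V}
    (h : v ∈ (genExpr (claG ι l u) (claP ι l u) r).vars) :
    ∃ q ≤ r, v = ι (CLAVar.g l (4 * u + q)) ∨ v = ι (CLAVar.p l (4 * u + q)) := by
  induction r with
  | zero =>
    simp only [genExpr, claG, BExpr.vars, Finset.mem_singleton] at h
    exact ⟨0, le_rfl, Or.inl h⟩
  | succ r ih =>
    simp only [genExpr, BExpr.vars, Finset.mem_union] at h
    rcases h with h | h | h
    · simp only [claG, BExpr.vars, Finset.mem_singleton] at h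
      exact ⟨_, le_rfl, Or.inl h⟩
    · simp only [claP, BExpr.vars, Finset.mem_singleton] at h
      exact ⟨_, le_rfl, Or.inr h⟩
    · obtain ⟨q, hq, h⟩ := ih h
      exact ⟨q, by omega, h⟩

theorem mem_vars_propExpr {ι : CLAVar → V} {l u r : ℕ} {v : V}
    (h : v ∈ (propExpr (claP ι l u) r).vars) :
    ∃ q ≤ r, v = ι (CLAVar.p l (4 * u + q)) := by
  induction r with
  | zero =>
    simp only [propExpr, claP, BExpr.vars, Finset.mem_singleton] at h
    exact ⟨0, le_rfl, h⟩
  | succ r ih =>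
    simp only [propExpr, BExpr.vars, Finset.mem_union] at h
    rcases h with h | h
    · simp only [claP, BExpr.vars, Finset.mem_singleton] at h
      exact ⟨_, le_rfl, h⟩
    · obtain ⟨q, hq, h⟩ := ih h
      exact ⟨q, by omega, h⟩

theorem mem_vars_claCarry {ι : CLAVar → V} {l u r : ℕ} {v : V}
    (h : v ∈ (claCarry ι l u r).vars) :
    v = ι (CLAVar.c (u * 4 ^ (l + 1))) ∨
      ∃ q ≤ r, v = ι (CLAVar.g l (4 * u + q)) ∨ v = ι (CLAVar.p l (4 * u + q)) := by
  simp only [claCarry, BExpr.vars, Finset.mem_union, Finset.mem_singleton] at h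
  rcases h with h | h | h
  · exact Or.inr (mem_vars_genExpr h)
  · exact Or.inl h
  · obtain ⟨q, hq, h⟩ := mem_vars_propExpr h
    exact Or.inr ⟨q, hq, Or.inr h⟩

/-- The variables of a carry-lookahead adder in the units (of the first `L + 1` layers) that
contain a column of the strip. -/
def claBox (k₀ k L : ℕ) : Finset CLAVar :=
  (Finset.Icc k₀ k ×ˢ Finset.range (L + 1) ×ˢ Finset.range 5).image
    (fun a => CLAVar.g a.2.1 (4 * (a.1 / 4 ^ (a.2.1 + 1)) + a.2.2)) ∪
  (Finset.Icc k₀ k ×ˢ Finset.range (L + 1) ×ˢ Finset.range 5).image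
    (fun a => CLAVar.p a.2.1 (4 * (a.1 / 4 ^ (a.2.1 + 1)) + a.2.2)) ∪
  (Finset.Icc k₀ k ×ˢ Finset.range (L + 1) ×ˢ Finset.range 5).image
    (fun a => CLAVar.c (a.1 / 4 ^ (a.2.1 + 1) * 4 ^ (a.2.1 + 1) + a.2.2 * 4 ^ a.2.1)) ∪
  (Finset.Icc k₀ k).image CLAVar.o

section

variable {k₀ k L i l q : ℕ} (h₀ : k₀ ≤ i) (h₁ : i ≤ k) (hl : l ≤ L) (hq : q ≤ 4)
include h₀ h₁

theorem o_mem_claBox : CLAVar.o i ∈ claBox k₀ k L := by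
  simp only [claBox, Finset.mem_union, Finset.mem_image, Finset.mem_Icc]
  exact Or.inr ⟨i, ⟨h₀, h₁⟩, rfl⟩

include hl hq

theorem g_mem_claBox : CLAVar.g l (4 * (i / 4 ^ (l + 1)) + q) ∈ claBox k₀ k L := by
  simp only [claBox, Finset.mem_union, Finset.mem_image, Finset.mem_product, Finset.mem_Icc,
    Finset.mem_range]
  exact Or.inl (Or.inl (Or.inl ⟨(i, l, q), ⟨⟨h₀, h₁⟩, Nat.lt_succ_of_le hl, Nat.lt_succ_of_le hq⟩, rfl⟩))

theorem p_mem_claBox : CLAVar.p l (4 * (i / 4 ^ (l + 1)) + q) ∈ claBox k₀ k L := by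
  simp only [claBox, Finset.mem_union, Finset.mem_image, Finset.mem_product, Finset.mem_Icc,
    Finset.mem_range]
  exact Or.inl (Or.inl (Or.inr ⟨(i, l, q), ⟨⟨h₀, h₁⟩, Nat.lt_succ_of_le hl, Nat.lt_succ_of_le hq⟩, rfl⟩))

/-- The value `q = 4` is needed for the carry out of the topmost unit. -/
theorem c_mem_claBox :
    CLAVar.c (i / 4 ^ (l + 1) * 4 ^ (l + 1) + q * 4 ^ l) ∈ claBox k₀ k L := by
  simp only [claBox, Finset.mem_union, Finset.mem_image, Finset.mem_product, Finset.mem_Icc,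
    Finset.mem_range]
  exact Or.inl (Or.inr ⟨(i, l, q), ⟨⟨h₀, h₁⟩, Nat.lt_succ_of_le hl, Nat.lt_succ_of_le hq⟩, rfl⟩)

end

theorem c_self_mem_claBox {k₀ k L i : ℕ} (h₀ : k₀ ≤ i) (h₁ : i ≤ k) :
    CLAVar.c i ∈ claBox k₀ k L := by
  have := c_mem_claBox (L := L) (l := 0) (q := i % 4) h₀ h₁ (by omega) (by omega)
  rwa [show i / 4 ^ (0 + 1) * 4 ^ (0 + 1) + i % 4 * 4 ^ 0 = i by
    simp only [zero_add, pow_one, pow_zero]; omega] at this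

theorem block_mem_claBox {k₀ k L i l : ℕ} (h₀ : k₀ ≤ i) (h₁ : i ≤ k) (hl : l ≤ L) :
    CLAVar.g l (i / 4 ^ l) ∈ claBox k₀ k L ∧ CLAVar.p l (i / 4 ^ l) ∈ claBox k₀ k L := by
  have h : i / 4 ^ l = 4 * (i / 4 ^ (l + 1)) + i / 4 ^ l % 4 := by
    rw [pow_succ, ← Nat.div_div_eq_div_mul]; omega
  rw [h]
  exact ⟨g_mem_claBox h₀ h₁ hl (by omega), p_mem_claBox h₀ h₁ hl (by omega)⟩

theorem card_claBox_le (k₀ k L : ℕ) :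
    (claBox k₀ k L).card ≤ 16 * ((k + 1 - k₀) * (L + 1)) := by
  have h1 : (Finset.Icc k₀ k ×ˢ Finset.range (L + 1) ×ˢ Finset.range 5).card =
      5 * ((k + 1 - k₀) * (L + 1)) := by
    simp only [Finset.card_product, Nat.card_Icc, Finset.card_range]; ring
  have h2 : k + 1 - k₀ ≤ (k + 1 - k₀) * (L + 1) := Nat.le_mul_of_pos_right _ (by omega)
  unfold claBox
  refine (Finset.card_union_le _ _).trans ?_
  refine (Nat.add_le_add ((Finset.card_union_le _ _).trans (Nat.add_le_add
    ((Finset.card_union_le _ _).trans (Nat.add_le_add Finset.card_image_le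
      Finset.card_image_le)) Finset.card_image_le)) Finset.card_image_le).trans ?_
  rw [h1, Nat.card_Icc]
  omega

/-- The whole adder is checked at time `0`. This is affordable, because each column meets only one
unit per layer. -/
theorem claStrip_of_satisfiesLocally {W k₀ k L : ℕ} {a b : ℕ → BExpr V} {ι : CLAVar → V}
    {σ : V → Bool} {live : ℤ → V → Prop} (hsat : SatisfiesLocally (claAdder W a b ι) live σ)
    (hL : claLayers W ≤ L) (hk : k₀ ≤ k) (hlive : ∀ v ∈ claBox k₀ k L, live 0 (ι v))
    (hab : ∀ i, k₀ ≤ i → i ≤ k → ∀ u, u ∈ (a i).vars ∨ u ∈ (b i).vars → live 0 u) :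
    CLAStrip W k₀ k a b ι σ := by
  have hpos := claLayers_pos W
  have hgp : ∀ {i l r : ℕ} {v : V}, k₀ ≤ i → i ≤ k → l ≤ L → r ≤ 4 →
      (∃ q ≤ r, v = ι (CLAVar.g l (4 * (i / 4 ^ (l + 1)) + q)) ∨
        v = ι (CLAVar.p l (4 * (i / 4 ^ (l + 1)) + q))) → live 0 v := by
    rintro i l r v h₀ h₁ hl hr ⟨q, hq, rfl | rfl⟩
    · exact hlive _ (g_mem_claBox h₀ h₁ hl (hq.trans hr))
    · exact hlive _ (p_mem_claBox h₀ h₁ hl (hq.trans hr))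
  have hcarry : ∀ {i l r : ℕ} {v : V}, k₀ ≤ i → i ≤ k → l ≤ L → r ≤ 4 →
      v ∈ (claCarry ι l (i / 4 ^ (l + 1)) r).vars → live 0 v := by
    intro i l r v h₀ h₁ hl hr hv
    rcases mem_vars_claCarry hv with rfl | hv
    · have := hlive _ (c_mem_claBox (q := 0) h₀ h₁ hl (by omega))
      simpa using this
    · exact hgp h₀ h₁ hl hr hv
  have hunit : ∀ {i : ℕ}, i < W → ∀ l < claLayers W,
      i / 4 ^ (l + 1) < 4 ^ (claLayers W - 1 - l) := by
    intro i hi l hl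
    rw [Nat.div_lt_iff_lt_mul (by positivity), ← pow_add,
      show claLayers W - 1 - l + (l + 1) = claLayers W by omega]
    exact hi.trans_le (le_four_pow_claLayers W)
  constructor
  · rintro rfl
    refine (hsat 0 (ι (CLAVar.c 0)) BExpr.zero ?_ (hlive _ (c_self_mem_claBox le_rfl hk))
      (by simp [BExpr.vars])).trans rfl
    intro C hC
    exact Or.inl (Or.inl (Or.inl (Or.inl hC)))
  · intro i h₀ h₁ hi
    refine hsat 0 _ (BExpr.and (a i) (b i)) ?_ (hlive _ ?_) ?_
    · intro C hC
      refine Or.inl (Or.inl (Or.inl (Or.inr ?_)))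
      simp only [Set.mem_iUnion]
      exact ⟨i, hi.trans_le (le_four_pow_claLayers W), Or.inl hC⟩
    · simpa using (block_mem_claBox (l := 0) h₀ h₁ (Nat.zero_le L)).1
    · intro u hu
      exact hab i h₀ h₁ u (Finset.mem_union.1 hu)
  · intro i h₀ h₁ hi
    refine hsat 0 _ (BExpr.xor (a i) (b i)) ?_ (hlive _ ?_) ?_
    · intro C hC
      refine Or.inl (Or.inl (Or.inl (Or.inr ?_)))
      simp only [Set.mem_iUnion]
      exact ⟨i, hi.trans_le (le_four_pow_claLayers W), Or.inr hC⟩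
    · simpa using (block_mem_claBox (l := 0) h₀ h₁ (Nat.zero_le L)).2
    · intro u hu
      exact hab i h₀ h₁ u (Finset.mem_union.1 hu)
  · intro i h₀ h₁ hi l hl
    refine hsat 0 _ _ ?_ (hlive _ (block_mem_claBox h₀ h₁ (by omega)).1) fun u hu =>
      hgp h₀ h₁ (by omega) (by omega) (mem_vars_genExpr hu)
    intro C hC
    refine Or.inl (Or.inl (Or.inr ?_))
    simp only [Set.mem_iUnion]
    exact ⟨l, hl, _, hunit hi l hl, Or.inl (Or.inl hC)⟩
  · intro i h₀ h₁ hi l hl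
    refine hsat 0 _ _ ?_ (hlive _ (block_mem_claBox h₀ h₁ (by omega)).2) fun u hu => ?_
    · intro C hC
      refine Or.inl (Or.inl (Or.inr ?_))
      simp only [Set.mem_iUnion]
      exact ⟨l, hl, _, hunit hi l hl, Or.inl (Or.inr hC)⟩
    · obtain ⟨q, hq, hu⟩ := mem_vars_propExpr hu
      exact hgp h₀ h₁ (show l ≤ L by omega) (show 3 ≤ 4 by omega) ⟨q, hq, Or.inr hu⟩
  · intro i h₀ h₁ hi l hl r hr
    refine hsat 0 _ _ ?_ (hlive _ (c_mem_claBox h₀ h₁ (by omega) (by omega))) fun u hu =>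
      hcarry h₀ h₁ (by omega) (by omega) hu
    intro C hC
    refine Or.inl (Or.inl (Or.inr ?_))
    simp only [Set.mem_iUnion]
    refine ⟨l, hl, _, hunit hi l hl, Or.inr ?_⟩
    simp only [Set.mem_iUnion]
    exact ⟨r, hr, hC⟩
  · intro i h₀ h₁ hi
    have h0 : i / 4 ^ (claLayers W - 1 + 1) = 0 := by
      rw [show claLayers W - 1 + 1 = claLayers W by omega]
      exact Nat.div_eq_of_lt (hi.trans_le (le_four_pow_claLayers W))
    have h4 : 4 ^ claLayers W = 4 * 4 ^ (claLayers W - 1) := by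
      conv_lhs => rw [show claLayers W = claLayers W - 1 + 1 by omega, pow_succ]
      ring
    have hc := c_mem_claBox (l := claLayers W - 1) (q := 4) h₀ h₁ (show _ ≤ L by omega) le_rfl
    rw [h0, Nat.zero_mul, Nat.zero_add, ← h4] at hc
    refine hsat 0 _ _ (fun C hC => Or.inl (Or.inr hC)) (hlive _ hc) fun u hu => ?_
    refine hcarry (l := claLayers W - 1) (r := 3) h₀ h₁ (by omega) (by omega) ?_
    rwa [h0]
  · intro i h₀ h₁ hi
    refine hsat 0 _ _ ?_ (hlive _ (o_mem_claBox h₀ h₁)) fun u hu => ?_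
    · intro C hC
      refine Or.inr ?_
      simp only [Set.mem_iUnion]
      exact ⟨i, hi, hC⟩
    · rcases mem_vars_sum3.1 hu with hu | hu
      · rw [BExpr.vars, Finset.mem_singleton] at hu
        rw [hu]
        exact hlive _ (c_self_mem_claBox h₀ h₁)
      · exact hab i h₀ h₁ u hu

/-- Adder `j` of layer `l` is checked at time `layerUnit Λ l * (3 * j) = layerUnit Λ (l + 1) * (2 *
j)`, when its inputs and its outputs are all live. The product at position `p` is checked at time
`layerUnit Λ 0 * p`. -/
theorem wallaceStrip_of_satisfiesLocally {m k₀ k L Λ : ℕ} {x y : ℕ → BExpr V}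
    {ι : WallaceVar → V} {σ : V → Bool} {live : ℤ → V → Prop}
    (hsat : SatisfiesLocally (wallaceMul m x y ι) live σ)
    (hL : claLayers (finalWidth m) ≤ L) (hΛ : lastLayer m ≤ Λ) (hk : k₀ ≤ k)
    (hcla : ∀ v ∈ claBox k₀ k L, live 0 (ι (WallaceVar.cla v)))
    (htab : ∀ l ≤ Λ, ∀ i, k₀ ≤ i → i ≤ k → ∀ p < colHeight m l i, ∀ τ,
      layerUnit Λ l * (p - 4) ≤ τ → τ ≤ layerUnit Λ l * (p + 4) →
        live τ (ι (WallaceVar.t l i p)))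
    (hxy : ∀ i, k₀ ≤ i → i ≤ k → ∀ p < colHeight m 0 i, ∀ u,
      u ∈ (x (i - (p + (i + 1 - m)))).vars ∨ u ∈ (y (p + (i + 1 - m))).vars →
        live (layerUnit Λ 0 * p) u) :
    WallaceStrip m k₀ k x y ι σ := by
  -- the inputs of the `j`-th adder of a column
  have hin : ∀ {l i j p : ℕ} {u : V}, l ≤ Λ → k₀ ≤ i → i ≤ k → 3 * j ≤ p → p ≤ 3 * j + 2 →
      u ∈ (tab m ι l i p).vars → live (layerUnit Λ l * (3 * j)) u := by
    intro l i j p u hl h₀ h₁ hp hp' hu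
    obtain ⟨hlt, rfl⟩ := mem_vars_tab.1 hu
    have h1 := layerUnit_pos Λ l
    refine htab l hl i h₀ h₁ p hlt _ ?_ ?_ <;> refine mul_le_mul_of_nonneg_left ?_ h1.le <;> omega
  -- the outputs of the `j`-th adder
  have hout : ∀ {l i j p : ℕ}, l < Λ → k₀ ≤ i → i ≤ k → p < colHeight m (l + 1) i →
      p ≤ 2 * j + 4 → 2 * j ≤ p + 4 →
      live (layerUnit Λ l * (3 * j)) (ι (WallaceVar.t (l + 1) i p)) := by
    intro l i j p hl h₀ h₁ hlt hp hp'
    have h1 := layerUnit_pos Λ (l + 1)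
    have h2 : layerUnit Λ l * (3 * j) = layerUnit Λ (l + 1) * (2 * j) := by
      linear_combination (-j : ℤ) * layerUnit_succ hl
    rw [h2]
    refine htab (l + 1) hl i h₀ h₁ p hlt _ ?_ ?_ <;>
      refine mul_le_mul_of_nonneg_left ?_ h1.le <;> omega
  constructor
  · intro i h₀ h₁ p hp
    refine hsat (layerUnit Λ 0 * p) _ (BExpr.and _ _) ?_ ?_ fun u hu =>
      hxy i h₀ h₁ p hp u (Finset.mem_union.1 hu)
    · intro C hC
      refine Or.inl (Or.inl ?_)
      simp only [partialProducts, Set.mem_iUnion]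
      exact ⟨i, p, hp, hC⟩
    · have h1 := layerUnit_pos Λ 0
      refine htab 0 (Nat.zero_le _) i h₀ h₁ p hp _ ?_ ?_ <;>
        refine mul_le_mul_of_nonneg_left ?_ h1.le <;> omega
  · intro i h₀ h₁ l hl j hj
    refine hsat (layerUnit Λ l * (3 * j)) _ _ ?_ ?_ fun u hu => ?_
    · intro C hC
      refine Or.inl (Or.inr ?_)
      simp only [Set.mem_iUnion]
      refine ⟨l, hl, Or.inl ?_⟩
      simp only [Set.mem_iUnion]
      exact ⟨i, j, hj, hC⟩
    · have h1 := sumCount_carryCount m l i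
      have h2 : j < sumCount m l i := by simp only [sumCount]; omega
      refine hout (by omega) h₀ h₁ ?_ ?_ ?_
      · rw [colHeight_succ]; omega
      · omega
      · omega
    · rcases mem_vars_sum3.1 hu with hu | hu | hu
      · exact hin (by omega) h₀ h₁ (by omega) (by omega) hu
      · exact hin (by omega) h₀ h₁ (by omega) (by omega) hu
      · exact hin (by omega) h₀ h₁ (by omega) (by omega) hu
  · intro i h₀ h₁ l hl j hj
    refine hsat (layerUnit Λ l * (3 * j)) _ _ ?_ ?_ fun u hu => ?_
    · intro C hC
      refine Or.inl (Or.inr ?_)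
      simp only [Set.mem_iUnion]
      refine ⟨l, hl, Or.inr ?_⟩
      simp only [Set.mem_iUnion]
      exact ⟨i, j, hj, hC⟩
    · have h1 := sumCount_carryCount m l (i + 1)
      have h2 : j < carryCount m l (i + 1) := by simp only [carryCount]; omega
      refine hout (by omega) (by omega) h₁ ?_ ?_ ?_
      · rw [colHeight_succ]; omega
      · omega
      · omega
    · rcases mem_vars_maj3.1 hu with hu | hu | hu
      · exact hin (by omega) h₀ (by omega) (by omega) (by omega) hu
      · exact hin (by omega) h₀ (by omega) (by omega) (by omega) hu
      · exact hin (by omega) h₀ (by omega) (by omega) (by omega) hu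
  · refine claStrip_of_satisfiesLocally (hsat.mono fun C hC => Or.inr hC) hL hk hcla ?_
    intro i h₀ h₁ u hu
    rcases hu with hu | hu
    -- The two rows of the last layer are live at time `0`, where the final adder is checked.
    · simpa using hin (j := 0) hΛ h₀ h₁ (by omega) (by omega) hu
    · simpa using hin (j := 0) hΛ h₀ h₁ (by omega) (by omega) hu

end Local

/-! ### Counting the variables of a strip -/

/-- The natural numbers between `s` and `s + d`. -/
noncomputable def natWindow (s : ℤ) (d : ℕ) : Finset ℕ := (Finset.Icc s (s + d)).image Int.toNat

theorem mem_natWindow {s : ℤ} {d r : ℕ} (h₁ : s ≤ r) (h₂ : (r : ℤ) ≤ s + d) :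
    r ∈ natWindow s d :=
  Finset.mem_image.2 ⟨r, Finset.mem_Icc.2 ⟨h₁, h₂⟩, Int.toNat_natCast r⟩

theorem card_natWindow_le (s : ℤ) (d : ℕ) : (natWindow s d).card ≤ d + 1 := by
  refine Finset.card_image_le.trans ?_
  rw [Int.card_Icc]
  omega

/-- The variables of a multiplier in a strip: the entries of the layers `l ≤ Λ` at the positions
`P l`, and the variables of the final adder. -/
def wallaceBox (k₀ k L Λ : ℕ) (P : ℕ → Finset ℕ) : Finset WallaceVar :=
  (Finset.range (Λ + 1) ×ˢ Finset.Icc k₀ k).biUnion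
    (fun a => (P a.1).image (WallaceVar.t a.1 a.2)) ∪
  (claBox k₀ k L).image WallaceVar.cla

theorem t_mem_wallaceBox {k₀ k L Λ : ℕ} {P : ℕ → Finset ℕ} {l i p : ℕ} :
    WallaceVar.t l i p ∈ wallaceBox k₀ k L Λ P ↔ l ≤ Λ ∧ (k₀ ≤ i ∧ i ≤ k) ∧ p ∈ P l := by
  simp only [wallaceBox, Finset.mem_union, Finset.mem_biUnion, Finset.mem_image,
    Finset.mem_product, Finset.mem_range, Finset.mem_Icc]
  constructor
  · rintro (⟨⟨l', i'⟩, ⟨h1, h2⟩, p', hp, h⟩ | ⟨v, -, h⟩)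
    · cases h
      exact ⟨Nat.le_of_lt_succ h1, h2, hp⟩
    · cases h
  · rintro ⟨h1, h2, h3⟩
    exact Or.inl ⟨(l, i), ⟨Nat.lt_succ_of_le h1, h2⟩, p, h3, rfl⟩

theorem cla_mem_wallaceBox {k₀ k L Λ : ℕ} {P : ℕ → Finset ℕ} {v : CLAVar} :
    WallaceVar.cla v ∈ wallaceBox k₀ k L Λ P ↔ v ∈ claBox k₀ k L := by
  simp [wallaceBox]

theorem card_wallaceBox_le (k₀ k L Λ : ℕ) (P : ℕ → Finset ℕ) (B : ℕ)
    (hP : ∀ l, (P l).card ≤ B) :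
    (wallaceBox k₀ k L Λ P).card ≤
      (Λ + 1) * (k + 1 - k₀) * B + 16 * ((k + 1 - k₀) * (L + 1)) := by
  refine (Finset.card_union_le _ _).trans (Nat.add_le_add ?_
    (Finset.card_image_le.trans (card_claBox_le k₀ k L)))
  refine (Finset.card_biUnion_le_card_mul _ _ B fun a _ =>
    Finset.card_image_le.trans (hP _)).trans ?_
  simp

namespace DistVar

/-- The variables of the distributivity instance in a strip. -/
def stripBox (k₀ k L Λ : ℕ) (X Y : Finset ℕ) (P : ℕ → Finset ℕ) : Finset DistVar :=
  X.image x ∪ (Y.image y ∪ Y.image z ∪ Y.image (fun j => addYZ (RippleVar.o j)) ∪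
    Y.image (fun j => addYZ (RippleVar.c j))) ∪
  ((wallaceBox k₀ k L Λ P).image mulXYZ ∪ (wallaceBox k₀ k L Λ P).image mulXY ∪
    (wallaceBox k₀ k L Λ P).image mulXZ) ∪
  ((Finset.Icc (k₀ - 1) k).image (fun i => addXYXZ (RippleVar.o i)) ∪
    (Finset.Icc (k₀ - 1) k).image (fun i => addXYXZ (RippleVar.c i)))

section

variable {k₀ k L Λ : ℕ} {X Y : Finset ℕ} {P : ℕ → Finset ℕ}

theorem x_mem_stripBox {r : ℕ} : x r ∈ stripBox k₀ k L Λ X Y P ↔ r ∈ X := by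
  simp [stripBox]

theorem y_mem_stripBox {j : ℕ} : y j ∈ stripBox k₀ k L Λ X Y P ↔ j ∈ Y := by
  simp [stripBox]

theorem z_mem_stripBox {j : ℕ} : z j ∈ stripBox k₀ k L Λ X Y P ↔ j ∈ Y := by
  simp [stripBox]

theorem addYZ_o_mem_stripBox {j : ℕ} :
    addYZ (RippleVar.o j) ∈ stripBox k₀ k L Λ X Y P ↔ j ∈ Y := by
  simp [stripBox]

theorem addYZ_c_mem_stripBox {j : ℕ} :
    addYZ (RippleVar.c j) ∈ stripBox k₀ k L Λ X Y P ↔ j ∈ Y := by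
  simp [stripBox]

theorem mulXYZ_mem_stripBox {v : WallaceVar} :
    mulXYZ v ∈ stripBox k₀ k L Λ X Y P ↔ v ∈ wallaceBox k₀ k L Λ P := by
  simp [stripBox]

theorem mulXY_mem_stripBox {v : WallaceVar} :
    mulXY v ∈ stripBox k₀ k L Λ X Y P ↔ v ∈ wallaceBox k₀ k L Λ P := by
  simp [stripBox]

theorem mulXZ_mem_stripBox {v : WallaceVar} :
    mulXZ v ∈ stripBox k₀ k L Λ X Y P ↔ v ∈ wallaceBox k₀ k L Λ P := by
  simp [stripBox]

theorem addXYXZ_o_mem_stripBox {i : ℕ} :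
    addXYXZ (RippleVar.o i) ∈ stripBox k₀ k L Λ X Y P ↔ k₀ ≤ i + 1 ∧ i ≤ k := by
  simp [stripBox]

/-- The bound `k₀ ≤ i + 1` admits the carry `c (k₀ - 1)` into the first column of the strip. -/
theorem addXYXZ_c_mem_stripBox {i : ℕ} :
    addXYXZ (RippleVar.c i) ∈ stripBox k₀ k L Λ X Y P ↔ k₀ ≤ i + 1 ∧ i ≤ k := by
  simp [stripBox]

theorem e_notMem_stripBox {i : ℕ} : e i ∉ stripBox k₀ k L Λ X Y P := by
  simp [stripBox]

theorem card_stripBox_le (k₀ k L Λ : ℕ) (X Y : Finset ℕ) (P : ℕ → Finset ℕ) (B : ℕ)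
    (hP : ∀ l, (P l).card ≤ B) :
    (stripBox k₀ k L Λ X Y P).card ≤ X.card + 4 * Y.card +
      3 * ((Λ + 1) * (k + 1 - k₀) * B + 16 * ((k + 1 - k₀) * (L + 1))) +
      2 * (k + 2 - k₀) := by
  have hW := card_wallaceBox_le k₀ k L Λ P B hP
  have hI : (Finset.Icc (k₀ - 1) k).card ≤ k + 2 - k₀ := by rw [Nat.card_Icc]; omega
  have h1 : (Y.image y ∪ Y.image z ∪ Y.image (fun j => addYZ (RippleVar.o j)) ∪
      Y.image (fun j => addYZ (RippleVar.c j))).card ≤ Y.card + Y.card + Y.card + Y.card :=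
    (Finset.card_union_le _ _).trans (Nat.add_le_add ((Finset.card_union_le _ _).trans
      (Nat.add_le_add ((Finset.card_union_le _ _).trans (Nat.add_le_add Finset.card_image_le
        Finset.card_image_le)) Finset.card_image_le)) Finset.card_image_le)
  have h2 := (Finset.card_union_le ((wallaceBox k₀ k L Λ P).image mulXYZ ∪
      (wallaceBox k₀ k L Λ P).image mulXY) ((wallaceBox k₀ k L Λ P).image mulXZ)).trans
    (Nat.add_le_add ((Finset.card_union_le _ _).trans (Nat.add_le_add Finset.card_image_le
      Finset.card_image_le)) Finset.card_image_le)
  have h3 := (Finset.card_union_le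
      ((Finset.Icc (k₀ - 1) k).image (fun i => addXYXZ (RippleVar.o i)))
      ((Finset.Icc (k₀ - 1) k).image (fun i => addXYXZ (RippleVar.c i)))).trans
    (Nat.add_le_add Finset.card_image_le Finset.card_image_le)
  have h4 := (Finset.card_union_le _ _).trans (Nat.add_le_add ((Finset.card_union_le _ _).trans
    (Nat.add_le_add ((Finset.card_union_le (X.image x) _).trans
      (Nat.add_le_add Finset.card_image_le h1)) h2)) h3)
  refine h4.trans ?_
  omega

end

/-! ### The schedule of the sweep -/

/-- The time from which a variable of the strip is remembered. -/
def liveFrom (n k₀ k Λ : ℕ) : DistVar → ℤ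
  | x r => layerUnit Λ 0 * ((min k₀ (n - 1) : ℕ) - r)
  | y j => layerUnit Λ 0 * (j - (k + 1 - n : ℕ))
  | z j => layerUnit Λ 0 * (j - (k + 1 - n : ℕ))
  | addYZ (RippleVar.o j) => layerUnit Λ 0 * (j - (k + 1 - n : ℕ))
  | addYZ (RippleVar.c j) => layerUnit Λ 0 * (j - (k + 1 - n : ℕ))
  | mulXYZ (WallaceVar.t l _ p) => layerUnit Λ l * (p - 4)
  | mulXY (WallaceVar.t l _ p) => layerUnit Λ l * (p - 4)
  | mulXZ (WallaceVar.t l _ p) => layerUnit Λ l * (p - 4)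
  | mulXYZ (WallaceVar.cla _) => 0
  | mulXY (WallaceVar.cla _) => 0
  | mulXZ (WallaceVar.cla _) => 0
  | addXYXZ _ => 0
  | e _ => 0

/-- The time until which a variable of the strip is remembered. -/
def liveUntil (n k₀ k Λ : ℕ) : DistVar → ℤ
  | x r => layerUnit Λ 0 * ((min k n : ℕ) - r)
  | y j => layerUnit Λ 0 * (j + 1 - (k₀ - n : ℕ))
  | z j => layerUnit Λ 0 * (j + 1 - (k₀ - n : ℕ))
  | addYZ (RippleVar.o j) => layerUnit Λ 0 * (j + 1 - (k₀ - n : ℕ))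
  | addYZ (RippleVar.c j) => layerUnit Λ 0 * (j + 1 - (k₀ - n : ℕ))
  | mulXYZ (WallaceVar.t l _ p) => layerUnit Λ l * (p + 4)
  | mulXY (WallaceVar.t l _ p) => layerUnit Λ l * (p + 4)
  | mulXZ (WallaceVar.t l _ p) => layerUnit Λ l * (p + 4)
  | mulXYZ (WallaceVar.cla _) => 0
  | mulXY (WallaceVar.cla _) => 0
  | mulXZ (WallaceVar.cla _) => 0
  | addXYXZ _ => 0
  | e _ => 0

/-- All variables of the strip. -/
def stripVars (n k₀ k L Λ : ℕ) : Finset DistVar :=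
  stripBox k₀ k L Λ (Finset.range n) (Finset.range (n + 1)) fun _ => Finset.range (n + 2)

theorem le_ediv_of_mul_le {w a τ : ℤ} (hw : 0 < w) (h : w * a ≤ τ) : a ≤ τ / w :=
  (Int.le_ediv_iff_mul_le hw).2 (by rwa [mul_comm])

theorem ediv_le_of_le_mul {w b τ : ℤ} (hw : 0 < w) (h : τ ≤ w * b) : τ / w ≤ b := by
  have := Int.ediv_le_ediv hw h
  rwa [Int.mul_ediv_cancel_left _ hw.ne'] at this

/-- Dividing `τ` by the time unit of a layer turns the live intervals into windows of consecutive
indices: at most nine positions per column and layer, and windows of length about `k - k₀` in the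
inputs and in the adder for `y + z`. -/
theorem live_subset_stripBox {n k₀ k L Λ : ℕ} (hk : k₀ ≤ k) (τ : ℤ) :
    (stripVars n k₀ k L Λ).filter
        (fun v => liveFrom n k₀ k Λ v ≤ τ ∧ τ ≤ liveUntil n k₀ k Λ v) ⊆
      stripBox k₀ k L Λ
        (natWindow ((min k₀ (n - 1) : ℕ) - τ / layerUnit Λ 0) (k - k₀ + 1))
        (natWindow (τ / layerUnit Λ 0 - 1 + (k₀ - n : ℕ)) (k - k₀ + 2))
        fun l => natWindow (τ / layerUnit Λ l - 4) 8 := by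
  intro v hv
  obtain ⟨hv, h1, h2⟩ := Finset.mem_filter.1 hv
  have hrow : ∀ j : ℕ, layerUnit Λ 0 * (j - (k + 1 - n : ℕ)) ≤ τ →
      τ ≤ layerUnit Λ 0 * (j + 1 - (k₀ - n : ℕ)) →
      j ∈ natWindow (τ / layerUnit Λ 0 - 1 + (k₀ - n : ℕ)) (k - k₀ + 2) := by
    intro j h1 h2
    have h1 := le_ediv_of_mul_le (layerUnit_pos Λ 0) h1
    have h2 := ediv_le_of_le_mul (layerUnit_pos Λ 0) h2
    exact mem_natWindow (by omega) (by omega)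
  have hpos : ∀ l p : ℕ, layerUnit Λ l * ((p : ℤ) - 4) ≤ τ → τ ≤ layerUnit Λ l * ((p : ℤ) + 4) →
      p ∈ natWindow (τ / layerUnit Λ l - 4) 8 := by
    intro l p h1 h2
    have h1 := le_ediv_of_mul_le (layerUnit_pos Λ l) h1
    have h2 := ediv_le_of_le_mul (layerUnit_pos Λ l) h2
    exact mem_natWindow (by omega) (by omega)
  have hmul : ∀ v : WallaceVar, v ∈ wallaceBox k₀ k L Λ (fun _ => Finset.range (n + 2)) →
      liveFrom n k₀ k Λ (mulXY v) ≤ τ → τ ≤ liveUntil n k₀ k Λ (mulXY v) →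
      v ∈ wallaceBox k₀ k L Λ fun l => natWindow (τ / layerUnit Λ l - 4) 8 := by
    rintro (⟨l, i, p⟩ | v) hv h1 h2
    · rw [t_mem_wallaceBox] at hv ⊢
      exact ⟨hv.1, hv.2.1, hpos l p h1 h2⟩
    · rwa [cla_mem_wallaceBox] at hv ⊢
  unfold stripVars at hv
  cases v with
  | x r =>
    rw [x_mem_stripBox]
    have h1 := le_ediv_of_mul_le (layerUnit_pos Λ 0) h1
    have h2 := ediv_le_of_le_mul (layerUnit_pos Λ 0) h2
    exact mem_natWindow (by omega) (by omega)
  | y j => exact y_mem_stripBox.2 (hrow j h1 h2)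
  | z j => exact z_mem_stripBox.2 (hrow j h1 h2)
  | addYZ v =>
    cases v with
    | o j => exact addYZ_o_mem_stripBox.2 (hrow j h1 h2)
    | c j => exact addYZ_c_mem_stripBox.2 (hrow j h1 h2)
  | mulXYZ v =>
    rw [mulXYZ_mem_stripBox] at hv ⊢
    exact hmul v hv (by cases v <;> exact h1) (by cases v <;> exact h2)
  | mulXY v =>
    rw [mulXY_mem_stripBox] at hv ⊢
    exact hmul v hv h1 h2
  | mulXZ v =>
    rw [mulXZ_mem_stripBox] at hv ⊢
    exact hmul v hv (by cases v <;> exact h1) (by cases v <;> exact h2)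
  | addXYXZ v =>
    cases v with
    | o i => rw [addXYXZ_o_mem_stripBox] at hv ⊢; exact hv
    | c i => rw [addXYXZ_c_mem_stripBox] at hv ⊢; exact hv
  | e i => exact absurd hv e_notMem_stripBox

/-- The variable `v` is known at time `τ` of the sweep over the strip that ends with column
`k`. -/
def Live (n k₀ k L Λ : ℕ) (τ : ℤ) (v : DistVar) : Prop :=
  (∃ i ≤ k, v = e i) ∨
    (v ∈ stripVars n k₀ k L Λ ∧ liveFrom n k₀ k Λ v ≤ τ ∧ τ ≤ liveUntil n k₀ k Λ v)

section

variable {n k₀ k L Λ : ℕ}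

/-- A time at which the row `j` is known. -/
structure RowTime (n k₀ k Λ j : ℕ) (τ : ℤ) : Prop where
  lower : layerUnit Λ 0 * (j - (k + 1 - n : ℕ)) ≤ τ
  upper : τ ≤ layerUnit Λ 0 * (j + 1 - (k₀ - n : ℕ))

theorem live_y {j : ℕ} {τ : ℤ} (hj : j ≤ n) (h : RowTime n k₀ k Λ j τ) :
    Live n k₀ k L Λ τ (y j) :=
  Or.inr ⟨y_mem_stripBox.2 (Finset.mem_range.2 (by omega)), h.1, h.2⟩

theorem live_z {j : ℕ} {τ : ℤ} (hj : j ≤ n) (h : RowTime n k₀ k Λ j τ) :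
    Live n k₀ k L Λ τ (z j) :=
  Or.inr ⟨z_mem_stripBox.2 (Finset.mem_range.2 (by omega)), h.1, h.2⟩

theorem live_addYZ_o {j : ℕ} {τ : ℤ} (hj : j ≤ n) (h : RowTime n k₀ k Λ j τ) :
    Live n k₀ k L Λ τ (addYZ (RippleVar.o j)) :=
  Or.inr ⟨addYZ_o_mem_stripBox.2 (Finset.mem_range.2 (by omega)), h.1, h.2⟩

theorem live_addYZ_c {j : ℕ} {τ : ℤ} (hj : j ≤ n) (h : RowTime n k₀ k Λ j τ) :
    Live n k₀ k L Λ τ (addYZ (RippleVar.c j)) :=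
  Or.inr ⟨addYZ_c_mem_stripBox.2 (Finset.mem_range.2 (by omega)), h.1, h.2⟩

/-- Entry `p` of column `i` of an `m`-bit tableau contains `x r` with `p + r = min i (m - 1)`. For
`m = n` or `m = n + 1` and columns of the strip this lies between the two bounds; the window of `x`
moves down as `p` grows. -/
theorem live_x {r p : ℕ} (hr : r < n) (h₁ : min k₀ (n - 1) ≤ p + r) (h₂ : p + r ≤ min k n) :
    Live n k₀ k L Λ (layerUnit Λ 0 * p) (x r) := by
  have h := (layerUnit_pos Λ 0).le
  refine Or.inr ⟨x_mem_stripBox.2 (Finset.mem_range.2 hr), ?_, ?_⟩ <;>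
    refine mul_le_mul_of_nonneg_left ?_ h <;> omega

/-- Entry `p` of column `i` lies in row `j = p + (i + 1 - m)`, and within the strip the shift stays
between `k₀ - n` and `k + 1 - n`. -/
theorem rowTime_product {j p : ℕ} (h₁ : j ≤ p + (k + 1 - n)) (h₂ : p + (k₀ - n) ≤ j + 1) :
    RowTime n k₀ k Λ j (layerUnit Λ 0 * p) := by
  have h := (layerUnit_pos Λ 0).le
  constructor <;> refine mul_le_mul_of_nonneg_left ?_ h <;> omega

/-- Column `i` of the adder for `y + z` is checked at this time. Row `j = i - 1` must still be known
because of its carry, which explains the `+ 1` in `liveUntil`. -/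
theorem rowTime_adder {i j : ℕ} (hk : k₀ ≤ k) (h₁ : i ≤ j + 1) (h₂ : j ≤ i) :
    RowTime n k₀ k Λ j (layerUnit Λ 0 * (i - (k₀ - n : ℕ))) := by
  have h := (layerUnit_pos Λ 0).le
  constructor <;> refine mul_le_mul_of_nonneg_left ?_ h <;> omega

theorem addYZ_strip {σ : DistVar → Bool}
    (hsat : SatisfiesLocally (wallaceDist n) (Live n k₀ k L Λ) σ) (hk : k₀ ≤ k) :
    RippleStrip n 0 k (bits n y) (bits n z) DistVar.addYZ σ := by
  have hs := hsat.mono (F' := rippleAdder n (bits n y) (bits n z) DistVar.addYZ)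
    fun C hC => Or.inl (Or.inl (Or.inl hC))
  have hin : ∀ i ≤ n, ∀ u ∈ (rippleCarryIn DistVar.addYZ i).vars,
      Live n k₀ k L Λ (layerUnit Λ 0 * (i - (k₀ - n : ℕ))) u := by
    intro i hi u hu
    cases i with
    | zero => simp [rippleCarryIn, BExpr.vars] at hu
    | succ i =>
      simp only [rippleCarryIn, BExpr.vars, Finset.mem_singleton] at hu
      rw [hu]
      exact live_addYZ_c (by omega) (rowTime_adder hk (by omega) (by omega))
  have hyz : ∀ i ≤ n, ∀ u, u ∈ (bits n y i).vars ∨ u ∈ (bits n z i).vars →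
      Live n k₀ k L Λ (layerUnit Λ 0 * (i - (k₀ - n : ℕ))) u := by
    rintro i hi u (hu | hu)
    · rw [(mem_vars_bits.1 hu).2]
      exact live_y hi (rowTime_adder hk (by omega) le_rfl)
    · rw [(mem_vars_bits.1 hu).2]
      exact live_z hi (rowTime_adder hk (by omega) le_rfl)
  constructor
  · intro i _ _ hi
    refine hs _ _ _ ?_ (live_addYZ_o hi.le (rowTime_adder hk (Nat.le_succ i) le_rfl))
      fun u hu => ?_
    · intro C hC
      refine Or.inl ?_
      simp only [Set.mem_iUnion]
      exact ⟨i, hi, Or.inl hC⟩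
    · rcases mem_vars_sum3.1 hu with hu | hu
      · exact hin i hi.le u hu
      · exact hyz i hi.le u hu
  · intro i _ _ hi
    refine hs _ _ _ ?_ (live_addYZ_c hi.le (rowTime_adder hk (Nat.le_succ i) le_rfl))
      fun u hu => ?_
    · intro C hC
      refine Or.inl ?_
      simp only [Set.mem_iUnion]
      exact ⟨i, hi, Or.inr hC⟩
    · rcases mem_vars_maj3.1 hu with hu | hu
      · exact hin i hi.le u hu
      · exact hyz i hi.le u hu
  · intro _ _
    exact hs _ _ _ (fun C hC => Or.inr hC)
      (live_addYZ_o le_rfl (rowTime_adder hk (Nat.le_succ n) le_rfl)) (hin n le_rfl)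

theorem addXYXZ_strip {σ : DistVar → Bool}
    (hsat : SatisfiesLocally (wallaceDist n) (Live n k₀ k L Λ) σ) :
    RippleStrip (wallaceOutputs n) k₀ k
      (bits (wallaceOutputs n) fun i => DistVar.mulXY (WallaceVar.cla (CLAVar.o i)))
      (bits (wallaceOutputs n) fun i => DistVar.mulXZ (WallaceVar.cla (CLAVar.o i)))
      DistVar.addXYXZ σ := by
  have hs := hsat.mono (F' := rippleAdder (wallaceOutputs n)
      (bits (wallaceOutputs n) fun i => DistVar.mulXY (WallaceVar.cla (CLAVar.o i)))
      (bits (wallaceOutputs n) fun i => DistVar.mulXZ (WallaceVar.cla (CLAVar.o i)))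
      DistVar.addXYXZ)
    fun C hC => Or.inl (Or.inr (Or.inr hC))
  have ho : ∀ i, k₀ ≤ i → i ≤ k → Live n k₀ k L Λ 0 (DistVar.addXYXZ (RippleVar.o i)) :=
    fun i h₀ h₁ => Or.inr ⟨addXYXZ_o_mem_stripBox.2 ⟨by omega, h₁⟩, le_rfl, le_rfl⟩
  have hc : ∀ i, k₀ ≤ i + 1 → i ≤ k → Live n k₀ k L Λ 0 (DistVar.addXYXZ (RippleVar.c i)) :=
    fun i h₀ h₁ => Or.inr ⟨addXYXZ_c_mem_stripBox.2 ⟨h₀, h₁⟩, le_rfl, le_rfl⟩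
  have hin : ∀ i, k₀ ≤ i → i ≤ k → ∀ u ∈ (rippleCarryIn DistVar.addXYXZ i).vars,
      Live n k₀ k L Λ 0 u := by
    intro i h₀ h₁ u hu
    cases i with
    | zero => simp [rippleCarryIn, BExpr.vars] at hu
    | succ i =>
      simp only [rippleCarryIn, BExpr.vars, Finset.mem_singleton] at hu
      rw [hu]
      exact hc i h₀ (by omega)
  have hab : ∀ i, k₀ ≤ i → i ≤ k → ∀ u,
      u ∈ (bits (wallaceOutputs n)
        (fun i => DistVar.mulXY (WallaceVar.cla (CLAVar.o i))) i).vars ∨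
      u ∈ (bits (wallaceOutputs n)
        (fun i => DistVar.mulXZ (WallaceVar.cla (CLAVar.o i))) i).vars →
      Live n k₀ k L Λ 0 u := by
    rintro i h₀ h₁ u (hu | hu)
    · rw [(mem_vars_bits.1 hu).2]
      exact Or.inr ⟨mulXY_mem_stripBox.2 (cla_mem_wallaceBox.2 (o_mem_claBox h₀ h₁)),
        le_rfl, le_rfl⟩
    · rw [(mem_vars_bits.1 hu).2]
      exact Or.inr ⟨mulXZ_mem_stripBox.2 (cla_mem_wallaceBox.2 (o_mem_claBox h₀ h₁)),
        le_rfl, le_rfl⟩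
  constructor
  · intro i h₀ h₁ hi
    refine hs 0 _ _ ?_ (ho i h₀ h₁) fun u hu => ?_
    · intro C hC
      refine Or.inl ?_
      simp only [Set.mem_iUnion]
      exact ⟨i, hi, Or.inl hC⟩
    · rcases mem_vars_sum3.1 hu with hu | hu
      · exact hin i h₀ h₁ u hu
      · exact hab i h₀ h₁ u hu
  · intro i h₀ h₁ hi
    refine hs 0 _ _ ?_ (hc i (by omega) h₁) fun u hu => ?_
    · intro C hC
      refine Or.inl ?_
      simp only [Set.mem_iUnion]
      exact ⟨i, hi, Or.inr hC⟩
    · rcases mem_vars_maj3.1 hu with hu | hu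
      · exact hin i h₀ h₁ u hu
      · exact hab i h₀ h₁ u hu
  · intro h₀ h₁
    exact hs 0 _ _ (fun C hC => Or.inr hC) (ho _ h₀ h₁) (hin _ h₀ h₁)

theorem colHeight_le_width {m l i p : ℕ} (hn : 1 ≤ n) (hm : m ≤ n + 1)
    (hp : p < colHeight m l i) : p < n + 2 := by
  have := colHeight_le m l i
  omega

theorem distStrip_of_satisfiesLocally {σ : DistVar → Bool}
    (hsat : SatisfiesLocally (wallaceDist n) (Live n k₀ k L Λ) σ) (hk : k₀ ≤ k) (hn : 1 ≤ n)
    (hkN : k < numOut n)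
    (hL : claLayers (finalWidth n) ≤ L) (hL' : claLayers (finalWidth (n + 1)) ≤ L)
    (hΛ : lastLayer n ≤ Λ) (hΛ' : lastLayer (n + 1) ≤ Λ) : DistStrip n k₀ k σ := by
  constructor
  · exact addYZ_strip hsat hk
  · refine wallaceStrip_of_satisfiesLocally
      (hsat.mono fun C hC => Or.inl (Or.inl (Or.inr hC))) hL' hΛ' hk ?_ ?_ ?_
    · exact fun v hv =>
        Or.inr ⟨mulXYZ_mem_stripBox.2 (cla_mem_wallaceBox.2 hv), le_rfl, le_rfl⟩
    · intro l hl i h₀ h₁ p hp τ h1 h2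
      exact Or.inr ⟨mulXYZ_mem_stripBox.2 (t_mem_wallaceBox.2 ⟨hl, ⟨h₀, h₁⟩,
        Finset.mem_range.2 (colHeight_le_width hn le_rfl hp)⟩), h1, h2⟩
    · intro i h₀ h₁ p hp u hu
      simp only [colHeight] at hp
      rcases hu with hu | hu
      · obtain ⟨hlt, rfl⟩ := mem_vars_bits.1 hu
        exact live_x hlt (by omega) (by omega)
      · obtain ⟨hlt, rfl⟩ := mem_vars_bits.1 hu
        exact live_addYZ_o (by omega) (rowTime_product (by omega) (by omega))
  · refine wallaceStrip_of_satisfiesLocally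
      (hsat.mono fun C hC => Or.inl (Or.inr (Or.inl (Or.inl hC)))) hL hΛ hk ?_ ?_ ?_
    · exact fun v hv =>
        Or.inr ⟨mulXY_mem_stripBox.2 (cla_mem_wallaceBox.2 hv), le_rfl, le_rfl⟩
    · intro l hl i h₀ h₁ p hp τ h1 h2
      exact Or.inr ⟨mulXY_mem_stripBox.2 (t_mem_wallaceBox.2 ⟨hl, ⟨h₀, h₁⟩,
        Finset.mem_range.2 (colHeight_le_width hn (Nat.le_succ n) hp)⟩), h1, h2⟩
    · intro i h₀ h₁ p hp u hu
      simp only [colHeight] at hp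
      rcases hu with hu | hu
      · obtain ⟨hlt, rfl⟩ := mem_vars_bits.1 hu
        exact live_x hlt (by omega) (by omega)
      · obtain ⟨hlt, rfl⟩ := mem_vars_bits.1 hu
        exact live_y (by omega) (rowTime_product (by omega) (by omega))
  · refine wallaceStrip_of_satisfiesLocally
      (hsat.mono fun C hC => Or.inl (Or.inr (Or.inl (Or.inr hC)))) hL hΛ hk ?_ ?_ ?_
    · exact fun v hv =>
        Or.inr ⟨mulXZ_mem_stripBox.2 (cla_mem_wallaceBox.2 hv), le_rfl, le_rfl⟩
    · intro l hl i h₀ h₁ p hp τ h1 h2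
      exact Or.inr ⟨mulXZ_mem_stripBox.2 (t_mem_wallaceBox.2 ⟨hl, ⟨h₀, h₁⟩,
        Finset.mem_range.2 (colHeight_le_width hn (Nat.le_succ n) hp)⟩), h1, h2⟩
    · intro i h₀ h₁ p hp u hu
      simp only [colHeight] at hp
      rcases hu with hu | hu
      · obtain ⟨hlt, rfl⟩ := mem_vars_bits.1 hu
        exact live_x hlt (by omega) (by omega)
      · obtain ⟨hlt, rfl⟩ := mem_vars_bits.1 hu
        exact live_z (by omega) (rowTime_product (by omega) (by omega))
  · exact addXYXZ_strip hsat
  · intro i h₀ h₁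
    refine hsat 0 _ (BExpr.xor (outL n i) (outR n i)) ?_ (Or.inl ⟨i, h₁, rfl⟩) fun u hu => ?_
    · intro C hC
      refine Or.inr (Or.inl ?_)
      simp only [Set.mem_iUnion]
      exact ⟨i, by omega, hC⟩
    · rcases Finset.mem_union.1 hu with hu | hu
      · rw [(mem_vars_bits.1 hu).2]
        exact Or.inr ⟨mulXYZ_mem_stripBox.2 (cla_mem_wallaceBox.2 (o_mem_claBox h₀ h₁)),
          le_rfl, le_rfl⟩
      · rw [(mem_vars_bits.1 hu).2]
        exact Or.inr ⟨addXYXZ_o_mem_stripBox.2 ⟨by omega, h₁⟩, le_rfl, le_rfl⟩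

end

/-! ### Size of the refutation -/

theorem numOut_le (n : ℕ) : numOut n ≤ 3 * n + 4 := by
  have h1 := finalWidth_le n
  have h2 := finalWidth_le (n + 1)
  simp only [numOut, wallaceOutputs]
  omega

/-- The strip has at most `2 * c + 5` columns, `2 * c` bounds the last layer and `c + 2` the
lookahead layers, so `1200 * c ^ 2` bounds the live variables. The total number of variables, at
most `900 * c ^ 2 * 2 ^ c`, enters only the depth. -/
theorem exists_regular_refutation {n c : ℕ} (hc : 2 ≤ c) (hn : 1 ≤ n) (hnc : n + 1 ≤ 2 ^ c) :
    ∃ π : ResolutionRefutation (wallaceDist n),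
      π.IsRegular ∧ π.size ≤ 2 ^ (1300 * c ^ 2) := by
  have hk₀ : ∀ k, k - (2 * c + 4) ≤ k := fun k => Nat.sub_le _ _
  have hD : ∀ k, k + 1 - (k - (2 * c + 4)) ≤ 5 * c := by intro k; omega
  have hD' : ∀ k, k + 2 - (k - (2 * c + 4)) ≤ 5 * c := by intro k; omega
  have hcc : c * 2 ≤ c * c := Nat.mul_le_mul_left c hc
  have hcard : ∀ k B, 3 * ((2 * c + 1) * (k + 1 - (k - (2 * c + 4))) * B +
      16 * ((k + 1 - (k - (2 * c + 4))) * (c + 2 + 1))) + 2 * (k + 2 - (k - (2 * c + 4))) ≤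
        45 * c ^ 2 * B + 725 * c ^ 2 := by
    intro k B
    have h1 : (2 * c + 1) * (k + 1 - (k - (2 * c + 4))) ≤ 3 * c * (5 * c) :=
      Nat.mul_le_mul (by omega) (hD k)
    have h2 : (k + 1 - (k - (2 * c + 4))) * (c + 2 + 1) ≤ 5 * c * (3 * c) :=
      Nat.mul_le_mul (hD k) (by omega)
    have h3 := Nat.mul_le_mul_right B h1
    have h4 := hD' k
    nlinarith
  obtain ⟨π, hπ, hsize⟩ := exists_refutation_of_pathwidth (F := wallaceDist n) (numOut n) e
    (fun i j h => by cases h; rfl) (Or.inr (Or.inr rfl)) (1200 * c ^ 2) (900 * c ^ 2 * 2 ^ c)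
    (fun k => stripVars n (k - (2 * c + 4)) k (c + 2) (2 * c))
    (fun k => liveFrom n (k - (2 * c + 4)) k (2 * c))
    (fun k => liveUntil n (k - (2 * c + 4)) k (2 * c)) (fun k _ i => e_notMem_stripBox)
    (by
      intro k _
      have h1 := card_stripBox_le (k - (2 * c + 4)) k (c + 2) (2 * c) (Finset.range n)
        (Finset.range (n + 1)) (fun _ => Finset.range (n + 2)) (n + 2) (fun _ => by simp)
      rw [Finset.card_range, Finset.card_range] at h1
      refine h1.trans ?_
      have h2 := hcard k (n + 2)
      have h3 : 45 * c ^ 2 * (n + 2) ≤ 45 * c ^ 2 * (2 * 2 ^ c) :=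
        Nat.mul_le_mul_left _ (by omega)
      have h4 : 725 * c ^ 2 * 1 ≤ 725 * c ^ 2 * 2 ^ c := Nat.mul_le_mul_left _ Nat.one_le_two_pow
      have h5 : 1 * 2 ^ c ≤ c ^ 2 * 2 ^ c := Nat.mul_le_mul_right _ (by nlinarith)
      nlinarith)
    (by
      intro k _ τ
      refine (Finset.card_le_card (live_subset_stripBox (hk₀ k) τ)).trans
        ((card_stripBox_le _ _ _ _ _ _ _ 9 fun l => card_natWindow_le _ _).trans ?_)
      have h1 := card_natWindow_le ((min (k - (2 * c + 4)) (n - 1) : ℕ) -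
        τ / layerUnit (2 * c) 0) (k - (k - (2 * c + 4)) + 1)
      have h2 := card_natWindow_le (τ / layerUnit (2 * c) 0 - 1 +
        (k - (2 * c + 4) - n : ℕ)) (k - (k - (2 * c + 4)) + 2)
      have h3 := hcard k 9
      have h4 : k - (k - (2 * c + 4)) ≤ 4 * c := by omega
      nlinarith)
    (by
      intro k hkN σ he hek
      by_contra hcon
      have hsat : SatisfiesLocally (wallaceDist n)
          (Live n (k - (2 * c + 4)) k (c + 2) (2 * c)) σ :=
        satisfiesLocally_of_not_falsified hcon
      have hstrip := distStrip_of_satisfiesLocally hsat (hk₀ k) hn hkN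
        (claLayers_le (by omega)) (claLayers_le hnc)
        (lastLayer_le_two_mul (by omega) (by omega)) (lastLayer_le_two_mul (by omega) hnc)
      refine hstrip.false hn (hk₀ k) ?_ he hek
      -- If the subtraction truncates, the strip starts at column `0` and no carries enter.
      -- Otherwise `2 ^ (2 * c + 4) = 16 * (2 ^ c) ^ 2` exceeds `4 * (n + 1) ^ 2`.
      rcases Nat.lt_or_ge (2 * c + 4) k with h1 | h1
      · refine Or.inr ?_
        rw [show k - (k - (2 * c + 4)) = 2 * c + 4 by omega, pow_add, mul_comm 2 c, pow_mul]
        have h2 : (n + 1) ^ 2 ≤ (2 ^ c) ^ 2 := Nat.pow_le_pow_left hnc 2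
        have h3 : 0 < (2 ^ c) ^ 2 := by positivity
        omega
      · exact Or.inl (by omega))
  refine ⟨π, hπ, hsize.trans_le ?_⟩
  have h1 := numOut_le n
  have h2 : c ^ 2 ≤ 2 ^ (2 * c) := by
    rw [mul_comm, pow_mul]
    exact Nat.pow_le_pow_left Nat.lt_two_pow_self.le 2
  have hq : 1 ≤ 2 ^ c := Nat.one_le_two_pow
  have h3 : numOut n + 900 * c ^ 2 * 2 ^ c + 1 ≤ 2 ^ 10 * 2 ^ (2 * c) * 2 ^ c := by
    have h4 : 900 * c ^ 2 * 2 ^ c ≤ 900 * 2 ^ (2 * c) * 2 ^ c :=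
      Nat.mul_le_mul_right _ (Nat.mul_le_mul_left _ h2)
    have h5 : 1 * 2 ^ c ≤ 2 ^ (2 * c) * 2 ^ c := Nat.mul_le_mul_right _ Nat.one_le_two_pow
    nlinarith
  have h4 : numOut n + 1 ≤ 2 ^ 3 * 2 ^ c := by omega
  calc (numOut n + 900 * c ^ 2 * 2 ^ c + 1) * ((numOut n + 1) * 2 ^ (1200 * c ^ 2)) + 1
      ≤ 2 ^ 10 * 2 ^ (2 * c) * 2 ^ c * (2 ^ 3 * 2 ^ c * 2 ^ (1200 * c ^ 2)) + 1 := by gcongr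
    _ = 2 ^ (13 + 4 * c + 1200 * c ^ 2) + 1 := by
      simp only [← pow_add]; congr 2; ring
    _ ≤ 2 ^ (13 + 4 * c + 1200 * c ^ 2) + 2 ^ (13 + 4 * c + 1200 * c ^ 2) := by
      gcongr; exact Nat.one_le_two_pow
    _ = 2 ^ (14 + 4 * c + 1200 * c ^ 2) := by rw [← two_mul, ← pow_succ']; congr 1; ring
    _ ≤ 2 ^ (1300 * c ^ 2) := Nat.pow_le_pow_right (by norm_num) (by nlinarith)

end DistVar

theorem mainTheorem8 :
    ∃ K : ℝ, ∀ n : ℕ, 2 ≤ n →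
      ∃ π : ResolutionRefutation (wallaceDist n),
        π.IsRegular ∧ (π.size : ℝ) ≤ (2 : ℝ) ^ (K * (Real.logb 2 (n : ℝ)) ^ 2) := by
  -- Here `c = Nat.log 2 n + 1` is at most twice the logarithm of `n`, and `5200 = 1300 * 2 ^ 2`.
  refine ⟨5200, fun n hn => ?_⟩
  have hlt : n < 2 ^ (Nat.log 2 n + 1) := Nat.lt_pow_succ_log_self (by norm_num) n
  have hlog : 1 ≤ Nat.log 2 n := Nat.log_pos (by norm_num) hn
  obtain ⟨π, hπ, hsize⟩ := DistVar.exists_regular_refutation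
    (c := Nat.log 2 n + 1) (by omega) (by omega) hlt
  refine ⟨π, hπ, ?_⟩
  have h1 : (Nat.log 2 n : ℝ) ≤ Real.logb 2 n := Real.natLog_le_logb n 2
  have h2 : (1 : ℝ) ≤ Nat.log 2 n := by exact_mod_cast hlog
  calc (π.size : ℝ) ≤ (2 : ℝ) ^ (1300 * (Nat.log 2 n + 1) ^ 2) := by exact_mod_cast hsize
    _ = (2 : ℝ) ^ (1300 * ((Nat.log 2 n : ℝ) + 1) ^ 2) := by
      rw [← Real.rpow_natCast]; push_cast; rfl
    _ ≤ (2 : ℝ) ^ (5200 * (Real.logb 2 (n : ℝ)) ^ 2) := by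
      refine Real.rpow_le_rpow_of_exponent_le one_le_two ?_
      have h3 : ((Nat.log 2 n : ℝ) + 1) ^ 2 ≤ (2 * Real.logb 2 n) ^ 2 :=
        pow_le_pow_left₀ (by linarith) (by linarith) 2
      calc 1300 * ((Nat.log 2 n : ℝ) + 1) ^ 2 ≤ 1300 * (2 * Real.logb 2 n) ^ 2 :=
            mul_le_mul_of_nonneg_left h3 (by norm_num)
        _ = 5200 * Real.logb 2 n ^ 2 := by ring
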